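/- Let $M$ be a compact smooth manifold (Hausdorff, without boundary) of real dimension four, let $g$ be a pseudo-Riemannian metric on $M$, that is, a smooth symmetric nondegenerate $(0,2)$ tensor field of arbitrary signature, and let $J$ be a smooth almost-complex structure on $M$, that is, a smooth field of endomorphisms $J_x:T_xM\to T_xM$ with $J_x^2=-\mathrm{Id}$. Suppose that $(M,g,J)$ is a pseudo-Kähler manifold: every $J_x$ is a linear $g_x$-isometry, and $\nabla J=0$ for the Levi-Civita connection $\nabla$ of $g$. Then every Killing vector field of $(M,g)$ is real holomorphic: if $v$ is a smooth vector field on $M$ with $\pounds_v g=0$, then $\pounds_v J=0$. (The $\partial\bar\partial$ property of the complex manifold $M$ is not assumed.) -/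

import Mathlib

open Bundle
open scoped Manifold ContDiff

noncomputable section

namespace PseudoKahler

section Definitions

variable {E : Type*} [NormedAddCommGroup E] [NormedSpace ℝ E]
  {H : Type*} [TopologicalSpace H] (I : ModelWithCorners ℝ E H)
  (M : Type*) [TopologicalSpace M] [ChartedSpace H M] [IsManifold I ∞ M]

/-- A pseudo-Riemannian metric: a smooth symmetric nondegenerate two-times covariant tensor field,
of arbitrary signature. -/
structure Metric where
  /-- The scalar product on each tangent space. -/
  val (x : M) : TangentSpace I x →L[ℝ] TangentSpace I x →L[ℝ] ℝ
  symm (x : M) (u w : TangentSpace I x) : val x u w = val x w u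
  nondegenerate (x : M) (u : TangentSpace I x) (hu : ∀ w, val x u w = 0) : u = 0
  contMDiff : ContMDiff I (I.prod 𝓘(ℝ, E →L[ℝ] E →L[ℝ] ℝ)) ∞
    (fun x : M ↦ TotalSpace.mk' (E →L[ℝ] E →L[ℝ] ℝ)
      (E := fun x : M ↦ TangentSpace I x →L[ℝ] TangentSpace I x →L[ℝ] ℝ) x (val x))

/-- An almost-complex structure: a smooth field of endomorphisms of the tangent spaces whose square
is minus the identity. -/
structure AlmostComplex where
  /-- The endomorphism of each tangent space. -/
  val (x : M) : TangentSpace I x →L[ℝ] TangentSpace I x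
  sq (x : M) (u : TangentSpace I x) : val x (val x u) = -u
  contMDiff : ContMDiff I (I.prod 𝓘(ℝ, E →L[ℝ] E)) ∞
    (fun x : M ↦ TotalSpace.mk' (E →L[ℝ] E)
      (E := fun x : M ↦ TangentSpace I x →L[ℝ] TangentSpace I x) x (val x))

variable {I M}

/-- The connection `D` is the Levi-Civita connection of `g`: it is torsion-free, and
`u (g(Y, Z)) = g(∇_u Y, Z) + g(Y, ∇_u Z)` for every tangent vector `u` at a point `x` and all
vector fields `Y, Z` differentiable at `x`. Here `D Y x u` stands for `∇_u Y`. -/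
structure IsLeviCivita [FiniteDimensional ℝ E] (g : Metric I M)
    (D : CovariantDerivative I E (TangentSpace I : M → Type _)) : Prop where
  torsion_free : ∀ (x : M) (X Y : Π y : M, TangentSpace I y),
    MDiffAt (T% X) x → MDiffAt (T% Y) x →
      D Y x (X x) - D X x (Y x) = VectorField.mlieBracket I X Y x
  metric : ∀ (x : M) (Y Z : Π y : M, TangentSpace I y) (u : TangentSpace I x),
    MDiffAt (T% Y) x → MDiffAt (T% Z) x →
      d% (fun y ↦ g.val y (Y y) (Z y)) x u =
        g.val x (D Y x u) (Z x) + g.val x (Y x) (D Z x u)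

/-- `J` is parallel for the connection `D`, that is, `∇_u (J Y) = J (∇_u Y)`. -/
def IsParallel (D : CovariantDerivative I E (TangentSpace I : M → Type _))
    (J : AlmostComplex I M) : Prop :=
  ∀ (x : M) (Y : Π y : M, TangentSpace I y) (u : TangentSpace I x), MDiffAt (T% Y) x →
    D (fun y ↦ J.val y (Y y)) x u = J.val x (D Y x u)

/-- The pair `g, J` makes `M` a pseudo-Kähler manifold: every `J x` is a linear isometry of `g x`,
and `J` is parallel for the Levi-Civita connection of `g`. -/
structure IsPseudoKahler [FiniteDimensional ℝ E] (g : Metric I M) (J : AlmostComplex I M) :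
    Prop where
  isometry : ∀ (x : M) (u w : TangentSpace I x), g.val x (J.val x u) (J.val x w) = g.val x u w
  parallel : ∃ D : CovariantDerivative I E (TangentSpace I : M → Type _),
    IsLeviCivita g D ∧ IsParallel D J

/-- The Lie derivative of the metric `g` along `v`, evaluated on two vector fields:
`(£_v g)(X, Y) = v (g(X, Y)) - g([v, X], Y) - g(X, [v, Y])`. -/
def lieDerivMetric (v : Π y : M, TangentSpace I y) (g : Metric I M)
    (X Y : Π y : M, TangentSpace I y) (x : M) : ℝ :=
  d% (fun y ↦ g.val y (X y) (Y y)) x (v x) - g.val x (VectorField.mlieBracket I v X x) (Y x)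
    - g.val x (X x) (VectorField.mlieBracket I v Y x)

/-- The Lie derivative of the endomorphism field `J` along `v`, evaluated on a vector field:
`(£_v J) X = [v, J X] - J [v, X]`. -/
def lieDerivComplex (v : Π y : M, TangentSpace I y) (J : AlmostComplex I M)
    (X : Π y : M, TangentSpace I y) (x : M) : TangentSpace I x :=
  VectorField.mlieBracket I v (fun y ↦ J.val y (X y)) x
    - J.val x (VectorField.mlieBracket I v X x)

/-- A Killing field of `g`: a smooth vector field `v` with `£_v g = 0`. -/
structure IsKilling (g : Metric I M) (v : Π y : M, TangentSpace I y) : Prop where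
  contMDiff : CMDiff ∞ (T% v)
  lieDeriv_eq_zero : ∀ (x : M) (X Y : Π y : M, TangentSpace I y),
    MDiffAt (T% X) x → MDiffAt (T% Y) x → lieDerivMetric v g X Y x = 0

/-- A real holomorphic vector field: a smooth vector field `v` with `£_v J = 0`. -/
structure IsRealHolomorphic (J : AlmostComplex I M) (v : Π y : M, TangentSpace I y) : Prop where
  contMDiff : CMDiff ∞ (T% v)
  lieDeriv_eq_zero : ∀ (x : M) (X : Π y : M, TangentSpace I y),
    MDiffAt (T% X) x → lieDerivComplex v J X x = 0

end Definitions

end PseudoKahler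

end

/-! Write A = ∇v, θ = g(Jv, ·) and α = g([J, A]·, ·). Since ∇ is torsion-free and J is parallel, £_v
J = [J, A]. As g is nondegenerate, it is enough to show α = 0.

Three facts about α give this. Both A (Killing equation) and J (isometry with square -1) are g-skew,
so [J, A] is skew and α is a two-form. As [J, A] anticommutes with J, α(J·, ·) = α(·, J·), so that α
is the real part of a (2,0)-form. Finally α = dθ (`extDeriv_kahlerOneForm`).

In real dimension four the square of such a form has a sign: on a frame e, Je, f, Jf the coefficient
of α ∧ α is 2(α(e, f)² + α(e, Jf)²), and this vanishes only if α = 0 (`wedgeCoeff_complexFrame`,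
`eq_zero_of_wedgeCoeff_eq_zero`). The positivity comes from the type of α and not from g, so the
signature plays no role. By exactness α ∧ α = d(θ ∧ dθ) has integral zero over the compact M, so α ∧
α = 0 and α = 0.

Integration is done by hand. Each `TangentSpace (𝓡 4) y` is the model space itself, so a four-form
is recorded at y by its value on the standard basis. That value need not be continuous in y;
multiplied by `coordDet` it becomes the coefficient in a chart, and the orientation by J turns it
into a density (`AlmostComplex.chartSign` is locally constant in a chart). Stokes' theorem is proved
for functions supported in one chart and globalised by a partition of unity in
`IsExteriorDerivative.topDensity_eq_zero`. -/

noncomputable section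

namespace PseudoKahler

/-! ### Linear algebra of two-forms and complex structures on four-space -/

section LinearAlgebra

/-- The coefficient of the wedge product of two alternating two-forms on a four-dimensional space,
in terms of the values of the forms on a basis. -/
def wedgeCoeff (a b : Fin 4 → Fin 4 → ℝ) : ℝ :=
  a 0 1 * b 2 3 - a 0 2 * b 1 3 + a 0 3 * b 1 2
    + a 2 3 * b 0 1 - a 1 3 * b 0 2 + a 1 2 * b 0 3

/-- The top exterior power of a linear map is its determinant. Both sides are expanded in 2×2
minors, the determinant by Laplace along pairs of columns. -/
theorem wedgeCoeff_transform (a b : Matrix (Fin 4) (Fin 4) ℝ) (M : Matrix (Fin 4) (Fin 4) ℝ)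
    (ha : ∀ i j, a i j = -a j i) (hb : ∀ i j, b i j = -b j i) :
    wedgeCoeff (M.transpose * a * M) (M.transpose * b * M) = M.det * wedgeCoeff a b := by
  have skew (c : Matrix (Fin 4) (Fin 4) ℝ) (hc : ∀ i j, c i j = -c j i) (i j : Fin 4) :
      (M.transpose * c * M) i j =
        c 0 1 * (M 0 i * M 1 j - M 1 i * M 0 j) + c 0 2 * (M 0 i * M 2 j - M 2 i * M 0 j)
        + c 0 3 * (M 0 i * M 3 j - M 3 i * M 0 j) + c 1 2 * (M 1 i * M 2 j - M 2 i * M 1 j)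
        + c 1 3 * (M 1 i * M 3 j - M 3 i * M 1 j) + c 2 3 * (M 2 i * M 3 j - M 3 i * M 2 j) := by
    have h0 (k : Fin 4) : c k k = 0 := by linarith [hc k k]
    simp only [Matrix.mul_apply, Fin.sum_univ_four, Matrix.transpose_apply, h0, hc 1 0, hc 2 0,
      hc 3 0, hc 2 1, hc 3 1, hc 3 2]
    ring
  have hdet : M.det =
      (M 0 0 * M 1 1 - M 1 0 * M 0 1) * (M 2 2 * M 3 3 - M 3 2 * M 2 3)
      - (M 0 0 * M 2 1 - M 2 0 * M 0 1) * (M 1 2 * M 3 3 - M 3 2 * M 1 3)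
      + (M 0 0 * M 3 1 - M 3 0 * M 0 1) * (M 1 2 * M 2 3 - M 2 2 * M 1 3)
      + (M 1 0 * M 2 1 - M 2 0 * M 1 1) * (M 0 2 * M 3 3 - M 3 2 * M 0 3)
      - (M 1 0 * M 3 1 - M 3 0 * M 1 1) * (M 0 2 * M 2 3 - M 2 2 * M 0 3)
      + (M 2 0 * M 3 1 - M 3 0 * M 2 1) * (M 0 2 * M 1 3 - M 1 2 * M 0 3) := by
    simp [Matrix.det_succ_row_zero, Fin.sum_univ_succ, Fin.succAbove]
    ring
  simp only [wedgeCoeff, skew a ha, skew b hb, hdet]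
  ring

/-- The coordinate matrix of four vectors. -/
def frameMatrix (u : Fin 4 → EuclideanSpace ℝ (Fin 4)) : Matrix (Fin 4) (Fin 4) ℝ :=
  Matrix.of fun i j ↦ u j i

/-- The standard basis. -/
def stdFrame (i : Fin 4) : EuclideanSpace ℝ (Fin 4) := EuclideanSpace.single i 1

theorem sum_smul_stdFrame (w : EuclideanSpace ℝ (Fin 4)) : ∑ i, w i • stdFrame i = w := by
  ext j
  fin_cases j <;> simp [stdFrame, Fin.sum_univ_four]

theorem bilin_frame (α : EuclideanSpace ℝ (Fin 4) →L[ℝ] EuclideanSpace ℝ (Fin 4) →L[ℝ] ℝ)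
    (u : Fin 4 → EuclideanSpace ℝ (Fin 4)) :
    (Matrix.of fun i j ↦ α (u i) (u j)) = (frameMatrix u).transpose *
      (Matrix.of fun i j ↦ α (stdFrame i) (stdFrame j)) * frameMatrix u := by
  ext i j
  conv_lhs => rw [Matrix.of_apply, ← sum_smul_stdFrame (u i), ← sum_smul_stdFrame (u j)]
  simp only [map_sum, map_smul, sum_apply, smul_apply,
    smul_eq_mul, Matrix.mul_apply, frameMatrix, Matrix.transpose_apply, Matrix.of_apply,
    Finset.sum_mul, Finset.mul_sum]
  refine Finset.sum_congr rfl fun k _ ↦ Finset.sum_congr rfl fun l _ ↦ ?_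
  ring

theorem wedgeCoeff_frame
    (α β : EuclideanSpace ℝ (Fin 4) →L[ℝ] EuclideanSpace ℝ (Fin 4) →L[ℝ] ℝ)
    (hα : ∀ x y, α x y = -α y x) (hβ : ∀ x y, β x y = -β y x)
    (u : Fin 4 → EuclideanSpace ℝ (Fin 4)) :
    wedgeCoeff (fun i j ↦ α (u i) (u j)) (fun i j ↦ β (u i) (u j)) = (frameMatrix u).det *
      wedgeCoeff (fun i j ↦ α (stdFrame i) (stdFrame j))
        (fun i j ↦ β (stdFrame i) (stdFrame j)) := by
  refine Eq.trans ?_ (wedgeCoeff_transform (Matrix.of fun i j ↦ α (stdFrame i) (stdFrame j))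
    (Matrix.of fun i j ↦ β (stdFrame i) (stdFrame j)) (frameMatrix u) (fun i j ↦ hα _ _)
    (fun i j ↦ hβ _ _))
  rw [← bilin_frame, ← bilin_frame]
  rfl

theorem frameMatrix_map (L : EuclideanSpace ℝ (Fin 4) →L[ℝ] EuclideanSpace ℝ (Fin 4))
    (u : Fin 4 → EuclideanSpace ℝ (Fin 4)) :
    (frameMatrix fun i ↦ L (u i)) = frameMatrix (fun i ↦ L (stdFrame i)) * frameMatrix u := by
  ext i j
  conv_lhs => rw [frameMatrix, Matrix.of_apply, ← sum_smul_stdFrame (u j)]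
  simp [Matrix.mul_apply, frameMatrix, map_sum, mul_comm]

theorem det_frameMatrix_stdFrame (L : EuclideanSpace ℝ (Fin 4) →L[ℝ] EuclideanSpace ℝ (Fin 4)) :
    (frameMatrix fun i ↦ L (stdFrame i)).det = L.det := by
  rw [ContinuousLinearMap.det, ← LinearMap.det_toMatrix (EuclideanSpace.basisFun (Fin 4) ℝ).toBasis]
  congr 1

/-- The frame `e, J e, f, J f`. -/
def complexFrame (J : EuclideanSpace ℝ (Fin 4) →L[ℝ] EuclideanSpace ℝ (Fin 4))
    (e f : EuclideanSpace ℝ (Fin 4)) : Fin 4 → EuclideanSpace ℝ (Fin 4) :=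
  ![e, J e, f, J f]

variable {J : EuclideanSpace ℝ (Fin 4) →L[ℝ] EuclideanSpace ℝ (Fin 4)}

theorem exists_det_complexFrame_ne_zero (hJ : ∀ x, J (J x) = -x) :
    ∃ e f, (frameMatrix (complexFrame J e f)).det ≠ 0 := by
  have he : stdFrame 0 ≠ 0 := by
    intro h
    simpa [stdFrame] using congrArg (fun w : EuclideanSpace ℝ (Fin 4) ↦ w 0) h
  set e := stdFrame 0 with he_def
  have hlt : Submodule.span ℝ (Set.range ![e, J e]) < ⊤ := by
    refine lt_top_iff_ne_top.2 fun h ↦ ?_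
    have h1 := finrank_range_le_card (R := ℝ) ![e, J e]
    rw [Set.finrank, h, finrank_top] at h1
    simp at h1
  obtain ⟨f, -, hf⟩ := SetLike.exists_of_lt hlt
  refine ⟨e, f, ?_⟩
  have hmem (a b : ℝ) : a • e + b • J e ∈ Submodule.span ℝ (Set.range ![e, J e]) :=
    add_mem (Submodule.smul_mem _ _ (Submodule.subset_span ⟨0, rfl⟩))
      (Submodule.smul_mem _ _ (Submodule.subset_span ⟨1, rfl⟩))
  rw [Ne, ← Matrix.exists_mulVec_eq_zero_iff]
  rintro ⟨c, hc0, hc⟩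
  have key : c 0 • e + c 1 • J e + c 2 • f + c 3 • J f = 0 := by
    ext i
    have := congrFun hc i
    simp only [Matrix.mulVec, dotProduct, frameMatrix, Matrix.of_apply, complexFrame,
      Fin.sum_univ_four, Matrix.cons_val, Pi.zero_apply] at this
    simp only [PiLp.add_apply, PiLp.smul_apply, smul_eq_mul, PiLp.zero_apply]
    linarith
  have keyJ : c 0 • J e - c 1 • e + c 2 • J f - c 3 • f = 0 := by
    have := congrArg J key
    simp only [map_add, map_smul, hJ, map_zero] at this
    rw [← this]; module
  -- The relation reads (c₀ + c₁J)e + (c₂ + c₃J)f = 0. Applying the conjugate c₂ - c₃J leaves (c₂² +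
  -- c₃²)f in the span of e and Je, against the choice of f.
  have hcd : c 2 ^ 2 + c 3 ^ 2 = 0 := by
    by_contra hne
    apply hf
    have : f = ((c 2 ^ 2 + c 3 ^ 2)⁻¹ * (-(c 2 * c 0) - c 3 * c 1)) • e
        + ((c 2 ^ 2 + c 3 ^ 2)⁻¹ * (-(c 2 * c 1) + c 3 * c 0)) • J e := by
      have h2 : (c 2 ^ 2 + c 3 ^ 2) • f =
          (-(c 2 * c 0) - c 3 * c 1) • e + (-(c 2 * c 1) + c 3 * c 0) • J e := by
        have := congrArg₂ (fun x y ↦ c 2 • x - c 3 • y) key keyJ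
        simp only [smul_zero, sub_zero] at this
        rw [← sub_eq_zero, ← this]; module
      rw [mul_smul, mul_smul, ← smul_add, ← h2, smul_smul, inv_mul_cancel₀ hne, one_smul]
    rw [this]; exact hmem _ _
  have h2 : c 2 = 0 := by nlinarith [sq_nonneg (c 2), sq_nonneg (c 3)]
  have h3 : c 3 = 0 := by nlinarith [sq_nonneg (c 2), sq_nonneg (c 3)]
  rw [h2, h3] at key keyJ
  have hab : (c 0 ^ 2 + c 1 ^ 2) • e = 0 := by
    have := congrArg₂ (fun x y ↦ c 0 • x - c 1 • y) key keyJ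
    simp only [smul_zero, sub_zero] at this
    rw [← this]; module
  have hab' : c 0 ^ 2 + c 1 ^ 2 = 0 := (smul_eq_zero.1 hab).resolve_right he
  have h0 : c 0 = 0 := by nlinarith [sq_nonneg (c 0), sq_nonneg (c 1)]
  have h1 : c 1 = 0 := by nlinarith [sq_nonneg (c 0), sq_nonneg (c 1)]
  apply hc0
  ext i
  fin_cases i <;> simp [h0, h1, h2, h3]

/-- A frame is a basis as soon as its coordinate matrix is invertible. -/
theorem exists_combination {u : Fin 4 → EuclideanSpace ℝ (Fin 4)} (hu : (frameMatrix u).det ≠ 0)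
    (w : EuclideanSpace ℝ (Fin 4)) : ∃ c : Fin 4 → ℝ, w = ∑ i, c i • u i := by
  refine ⟨(frameMatrix u)⁻¹.mulVec w.ofLp, ?_⟩
  have h : (frameMatrix u).mulVec ((frameMatrix u)⁻¹.mulVec w.ofLp) = w.ofLp := by
    rw [Matrix.mulVec_mulVec, Matrix.mul_nonsing_inv _ (isUnit_iff_ne_zero.2 hu),
      Matrix.one_mulVec]
  ext i
  rw [← congrFun h i]
  simp [Matrix.mulVec, dotProduct, frameMatrix, mul_comm, Fin.sum_univ_four]

/-- Two complex frames differ by a complex 2×2 matrix, whose determinant as a real 4×4 matrix is the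
squared modulus of its complex determinant. This is why J determines an orientation. -/
theorem det_complexFrame_mul_nonneg (hJ : ∀ x, J (J x) = -x) (e f e' f' : EuclideanSpace ℝ (Fin 4)) :
    0 ≤ (frameMatrix (complexFrame J e f)).det * (frameMatrix (complexFrame J e' f')).det := by
  by_cases h0 : (frameMatrix (complexFrame J e' f')).det = 0
  · simp [h0]
  obtain ⟨a, ha⟩ := exists_combination h0 e
  obtain ⟨b, hb⟩ := exists_combination h0 f
  simp only [complexFrame, Fin.sum_univ_four, Matrix.cons_val] at ha hb
  have hJa : J e = a 0 • J e' - a 1 • e' + a 2 • J f' - a 3 • f' := by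
    rw [ha]; simp only [map_add, map_smul, hJ]; module
  have hJb : J f = b 0 • J e' - b 1 • e' + b 2 • J f' - b 3 • f' := by
    rw [hb]; simp only [map_add, map_smul, hJ]; module
  have hM : frameMatrix (complexFrame J e f) = frameMatrix (complexFrame J e' f') *
      !![a 0, -a 1, b 0, -b 1; a 1, a 0, b 1, b 0; a 2, -a 3, b 2, -b 3; a 3, a 2, b 3, b 2] := by
    ext i j
    have h0 := congrArg (fun w : EuclideanSpace ℝ (Fin 4) ↦ w i) ha
    have h1 := congrArg (fun w : EuclideanSpace ℝ (Fin 4) ↦ w i) hJa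
    have h2 := congrArg (fun w : EuclideanSpace ℝ (Fin 4) ↦ w i) hb
    have h3 := congrArg (fun w : EuclideanSpace ℝ (Fin 4) ↦ w i) hJb
    simp only [PiLp.add_apply, PiLp.sub_apply, PiLp.smul_apply, smul_eq_mul] at h0 h1 h2 h3
    fin_cases j <;>
      simp [Matrix.mul_apply, frameMatrix, complexFrame, Fin.sum_univ_four] <;> linarith
  have hd : (!![a 0, -a 1, b 0, -b 1; a 1, a 0, b 1, b 0; a 2, -a 3, b 2, -b 3;
      a 3, a 2, b 3, b 2] : Matrix (Fin 4) (Fin 4) ℝ).det =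
      (a 0 * b 2 - a 1 * b 3 - a 2 * b 0 + a 3 * b 1) ^ 2
      + (a 0 * b 3 + a 1 * b 2 - a 2 * b 1 - a 3 * b 0) ^ 2 := by
    simp [Matrix.det_succ_row_zero, Fin.sum_univ_succ, Fin.succAbove]
    ring
  rw [hM, Matrix.det_mul, hd, mul_right_comm]
  exact mul_nonneg (mul_self_nonneg _) (by positivity)

open Classical in
/-- The sign of the orientation given by the complex structure `J`. -/
def orientationSign (J : EuclideanSpace ℝ (Fin 4) →L[ℝ] EuclideanSpace ℝ (Fin 4)) : ℝ :=
  if ∃ e f, 0 < (frameMatrix (complexFrame J e f)).det then 1 else -1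

theorem orientationSign_eq (hJ : ∀ x, J (J x) = -x) {e f : EuclideanSpace ℝ (Fin 4)}
    (h : (frameMatrix (complexFrame J e f)).det ≠ 0) :
    orientationSign J = SignType.sign (frameMatrix (complexFrame J e f)).det := by
  unfold orientationSign
  rcases lt_or_gt_of_ne h with h | h
  · rw [if_neg, sign_neg h]
    · simp
    · rintro ⟨e', f', h'⟩
      nlinarith [det_complexFrame_mul_nonneg hJ e f e' f', mul_pos h' (neg_pos.2 h)]
  · rw [if_pos ⟨e, f, h⟩, sign_pos h]
    simp

variable {α : EuclideanSpace ℝ (Fin 4) →L[ℝ] EuclideanSpace ℝ (Fin 4) →L[ℝ] ℝ}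

/-- The type condition gives α(x, Jx) = 0, α(Je, Jf) = -α(e, f) and α(Je, f) = α(e, Jf), which turns
the remaining products into squares. -/
theorem wedgeCoeff_complexFrame (hJ : ∀ x, J (J x) = -x) (hα : ∀ x y, α x y = -α y x)
    (hαJ : ∀ x y, α (J x) y = α x (J y)) (e f : EuclideanSpace ℝ (Fin 4)) :
    wedgeCoeff (fun i j ↦ α (complexFrame J e f i) (complexFrame J e f j))
      (fun i j ↦ α (complexFrame J e f i) (complexFrame J e f j))
        = 2 * (α e f ^ 2 + α e (J f) ^ 2) := by
  have h1 (x) : α x (J x) = 0 := by linarith [hα x (J x), hαJ x x]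
  simp only [wedgeCoeff, complexFrame, Matrix.cons_val, h1, hαJ, hJ, map_neg]
  ring

theorem orientationSign_mul_wedgeCoeff_nonneg (hJ : ∀ x, J (J x) = -x)
    (hα : ∀ x y, α x y = -α y x) (hαJ : ∀ x y, α (J x) y = α x (J y)) :
    0 ≤ orientationSign J * wedgeCoeff (fun i j ↦ α (stdFrame i) (stdFrame j))
      (fun i j ↦ α (stdFrame i) (stdFrame j)) := by
  obtain ⟨e, f, hef⟩ := exists_det_complexFrame_ne_zero hJ
  have h := wedgeCoeff_frame α α hα hα (complexFrame J e f)
  rw [wedgeCoeff_complexFrame hJ hα hαJ] at h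
  rw [orientationSign_eq hJ hef]
  refine nonneg_of_mul_nonneg_right (a := |(frameMatrix (complexFrame J e f)).det|) ?_
    (abs_pos.2 hef)
  rw [← mul_assoc, abs_mul_sign, ← h]
  positivity

/-- All values of α on a complex frame are determined by α(e, f) and α(e, Jf), and the square of α
is a sum of squares of these two numbers. -/
theorem eq_zero_of_wedgeCoeff_eq_zero (hJ : ∀ x, J (J x) = -x)
    (hα : ∀ x y, α x y = -α y x) (hαJ : ∀ x y, α (J x) y = α x (J y))
    (h0 : wedgeCoeff (fun i j ↦ α (stdFrame i) (stdFrame j))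
      (fun i j ↦ α (stdFrame i) (stdFrame j)) = 0) : α = 0 := by
  obtain ⟨e, f, hef⟩ := exists_det_complexFrame_ne_zero hJ
  have h := wedgeCoeff_frame α α hα hα (complexFrame J e f)
  rw [wedgeCoeff_complexFrame hJ hα hαJ, h0, mul_zero] at h
  have h1 : α e f = 0 := by nlinarith [sq_nonneg (α e f), sq_nonneg (α e (J f))]
  have h2 : α e (J f) = 0 := by nlinarith [sq_nonneg (α e f), sq_nonneg (α e (J f))]
  have h1' : α f e = 0 := by rw [hα, h1, neg_zero]
  have h2' : α f (J e) = 0 := by rw [← hαJ, hα, h2, neg_zero]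
  have h3 (x) : α x (J x) = 0 := by linarith [hα x (J x), hαJ x x]
  have h4 (x) : α x x = 0 := by linarith [hα x x]
  ext x y
  obtain ⟨a, rfl⟩ := exists_combination hef x
  obtain ⟨b, rfl⟩ := exists_combination hef y
  simp [complexFrame, Fin.sum_univ_four, h1, h2, h1', h2', h3, h4, hαJ, hJ]

end LinearAlgebra

/-! ### Stokes' theorem in four-space -/

section EuclideanStokes

open MeasureTheory

/-- The matrix of the exterior derivative of the one-form with components `T`. -/
def extDerivMatrix (T : Fin 4 → EuclideanSpace ℝ (Fin 4) → ℝ) (x : EuclideanSpace ℝ (Fin 4))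
    (a b : Fin 4) : ℝ :=
  fderiv ℝ (T b) x (stdFrame a) - fderiv ℝ (T a) x (stdFrame b)

/-- The matrix of the wedge product of the differential of `F` and the one-form with
components `T`. -/
def diffWedgeMatrix (F : EuclideanSpace ℝ (Fin 4) → ℝ) (T : Fin 4 → EuclideanSpace ℝ (Fin 4) → ℝ)
    (x : EuclideanSpace ℝ (Fin 4)) (a b : Fin 4) : ℝ :=
  fderiv ℝ F x (stdFrame a) * T b x - fderiv ℝ F x (stdFrame b) * T a x

/-- Integration by parts against the constant function 1. -/
theorem integral_fderiv_eq_zero {W : EuclideanSpace ℝ (Fin 4) → ℝ} (hW : ContDiff ℝ 1 W)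
    (hc : HasCompactSupport W) (e : EuclideanSpace ℝ (Fin 4)) : ∫ x, fderiv ℝ W x e = 0 := by
  have h := integral_mul_fderiv_eq_neg_fderiv_mul_of_integrable (μ := volume)
    (f := fun _ : EuclideanSpace ℝ (Fin 4) ↦ (1 : ℝ)) (g := W) (v := e)
    (by simp)
    (by
      simpa using (((hW.continuous_fderiv one_ne_zero).clm_apply
        continuous_const).integrable_of_hasCompactSupport (hc.fderiv_apply (𝕜 := ℝ) e)))
    (by simpa using hW.continuous.integrable_of_hasCompactSupport hc)
    (fun x _ ↦ differentiableAt_const _) (fun x _ ↦ (hW.differentiable one_ne_zero) x)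
  simpa using h

theorem integrable_fderiv {W : EuclideanSpace ℝ (Fin 4) → ℝ} (hW : ContDiff ℝ 1 W)
    (hc : HasCompactSupport W) (e : EuclideanSpace ℝ (Fin 4)) :
    Integrable (fun x ↦ fderiv ℝ W x e) :=
  ((hW.continuous_fderiv one_ne_zero).clm_apply
    continuous_const).integrable_of_hasCompactSupport (hc.fderiv_apply (𝕜 := ℝ) e)

variable {U : Set (EuclideanSpace ℝ (Fin 4))} {s F : EuclideanSpace ℝ (Fin 4) → ℝ}
  {T : Fin 4 → EuclideanSpace ℝ (Fin 4) → ℝ}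

/-- Nothing is assumed about s and w off U: there F vanishes near every point, and within U the
factor s is locally constant. -/
theorem contDiff_mul_mul {w : EuclideanSpace ℝ (Fin 4) → ℝ} (hU : IsOpen U)
    (hs : ∀ x ∈ U, ∀ᶠ z in nhds x, s z = s x) (hF : ContDiff ℝ 1 F) (hFU : tsupport F ⊆ U)
    (hw : ContDiffOn ℝ 1 w U) : ContDiff ℝ 1 fun x ↦ s x * (F x * w x) := by
  refine contDiff_iff_contDiffAt.2 fun x ↦ ?_
  by_cases hx : x ∈ U
  · refine ContDiffAt.congr_of_eventuallyEq (f := fun z ↦ s x * (F z * w z)) ?_ ?_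
    · exact contDiffAt_const.mul (hF.contDiffAt.mul (hw.contDiffAt (hU.mem_nhds hx)))
    · filter_upwards [hs x hx] with z hz
      rw [hz]
  · refine ContDiffAt.congr_of_eventuallyEq (f := fun _ ↦ 0) contDiffAt_const ?_
    filter_upwards [notMem_tsupport_iff_eventuallyEq.1 fun h ↦ hx (hFU h)] with z hz
    simp [hz]

theorem fderiv_mul_mul {w : EuclideanSpace ℝ (Fin 4) → ℝ} (hU : IsOpen U)
    (hs : ∀ x ∈ U, ∀ᶠ z in nhds x, s z = s x) (hF : ContDiff ℝ 1 F)
    (hw : ContDiffOn ℝ 1 w U) {x : EuclideanSpace ℝ (Fin 4)} (hx : x ∈ U)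
    (e : EuclideanSpace ℝ (Fin 4)) :
    fderiv ℝ (fun x ↦ s x * (F x * w x)) x e =
      s x * (fderiv ℝ F x e * w x + F x * fderiv ℝ w x e) := by
  have h : (fun x ↦ s x * (F x * w x)) =ᶠ[nhds x] fun z ↦ s x * (F z * w z) := by
    filter_upwards [hs x hx] with z hz
    rw [hz]
  have hF' := (hF.differentiable one_ne_zero) x
  have hw' := (hw.contDiffAt (hU.mem_nhds hx)).differentiableAt one_ne_zero
  rw [h.fderiv_eq, ((hF'.hasFDerivAt.fun_mul hw'.hasFDerivAt).const_mul (s x)).fderiv]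
  simp
  ring

/-- Stokes' theorem for the three-form `F • T ∧ dT` with compact support in an open subset of
four-space, with a locally constant orientation sign. -/
theorem integral_wedge_extDeriv (hU : IsOpen U)
    (hs : ∀ x ∈ U, ∀ᶠ z in nhds x, s z = s x) (hF : ContDiff ℝ 1 F) (hFU : tsupport F ⊆ U)
    (hFc : HasCompactSupport F) (hT : ∀ b, ContDiffOn ℝ ∞ (T b) U) :
    ∫ x in U, s x * (F x * wedgeCoeff (extDerivMatrix T x) (extDerivMatrix T x)
      + wedgeCoeff (diffWedgeMatrix F T x) (extDerivMatrix T x)) = 0 := by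
  have hT' (b : Fin 4) (e : EuclideanSpace ℝ (Fin 4)) :
      ContDiffOn ℝ 1 (fun x ↦ fderiv ℝ (T b) x e) U :=
    ((hT b).fderiv_of_isOpen (m := 1) hU (by norm_cast)).clm_apply
      contDiffOn_const
  have hα (a b : Fin 4) : ContDiffOn ℝ 1 (fun x ↦ extDerivMatrix T x a b) U :=
    (hT' b _).sub (hT' a _)
  have hT1 (b : Fin 4) : ContDiffOn ℝ 1 (T b) U := (hT b).of_le (by norm_cast)
  -- The components of the three-form T ∧ dT.
  let η (b c d : Fin 4) (x : EuclideanSpace ℝ (Fin 4)) : ℝ :=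
    T b x * extDerivMatrix T x c d - T c x * extDerivMatrix T x b d
      + T d x * extDerivMatrix T x b c
  have hη (b c d : Fin 4) : ContDiffOn ℝ 1 (η b c d) U :=
    (((hT1 b).mul (hα c d)).sub ((hT1 c).mul (hα b d))).add ((hT1 d).mul (hα b c))
  have hW (b c d : Fin 4) : ContDiff ℝ 1 fun x ↦ s x * (F x * η b c d x) :=
    contDiff_mul_mul hU hs hF hFU (hη b c d)
  have hWc (b c d : Fin 4) : HasCompactSupport fun x ↦ s x * (F x * η b c d x) :=
    (hFc.mul_right (f' := η b c d)).mul_left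
  have h0 (b c d : Fin 4) (e : EuclideanSpace ℝ (Fin 4)) :=
    integral_fderiv_eq_zero (hW b c d) (hWc b c d) e
  have hi (b c d : Fin 4) (e : EuclideanSpace ℝ (Fin 4)) :=
    integrable_fderiv (hW b c d) (hWc b c d) e
  -- The integrand is the coefficient of d(sF η); the signs alternate with the index missing from η.
  have hsum : ∫ x, (fderiv ℝ (fun x ↦ s x * (F x * η 1 2 3 x)) x (stdFrame 0)
      - fderiv ℝ (fun x ↦ s x * (F x * η 0 2 3 x)) x (stdFrame 1)
      + fderiv ℝ (fun x ↦ s x * (F x * η 0 1 3 x)) x (stdFrame 2)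
      - fderiv ℝ (fun x ↦ s x * (F x * η 0 1 2 x)) x (stdFrame 3)) = 0 := by
    rw [integral_sub, integral_add, integral_sub, h0, h0, h0, h0]
    · simp
    · exact hi _ _ _ _
    · exact hi _ _ _ _
    · exact (hi _ _ _ _).sub (hi _ _ _ _)
    · exact hi _ _ _ _
    · exact ((hi _ _ _ _).sub (hi _ _ _ _)).add (hi _ _ _ _)
    · exact hi _ _ _ _
  rw [← setIntegral_eq_integral_of_forall_compl_eq_zero (s := U)] at hsum
  · rw [← hsum]
    refine setIntegral_congr_fun hU.measurableSet fun x hx ↦ ?_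
    -- Symmetry of second derivatives, that is d(dT) = 0, cancels every term in which dT is
    -- differentiated.
    have hsymm (a b c : Fin 4) : fderiv ℝ (fun z ↦ fderiv ℝ (T b) z (stdFrame a)) x (stdFrame c) =
        fderiv ℝ (fun z ↦ fderiv ℝ (T b) z (stdFrame c)) x (stdFrame a) := by
      have hd : DifferentiableAt ℝ (fderiv ℝ (T b)) x :=
        (((hT b).fderiv_of_isOpen (m := 1) hU (by norm_cast)).contDiffAt
          (hU.mem_nhds hx)).differentiableAt one_ne_zero
      have hc (e : EuclideanSpace ℝ (Fin 4)) : fderiv ℝ (fun z ↦ fderiv ℝ (T b) z e) x =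
          (fderiv ℝ (fderiv ℝ (T b)) x).flip e := by
        rw [fderiv_clm_apply hd (differentiableAt_const e)]
        simp
      rw [hc, hc]
      exact ((hT b).contDiffAt (hU.mem_nhds hx)).isSymmSndFDerivAt (by simp; norm_cast) _ _
    have hdα (a b c : Fin 4) : fderiv ℝ (fun z ↦ extDerivMatrix T z a b) x (stdFrame c) =
        fderiv ℝ (fun z ↦ fderiv ℝ (T b) z (stdFrame a)) x (stdFrame c)
          - fderiv ℝ (fun z ↦ fderiv ℝ (T a) z (stdFrame b)) x (stdFrame c) := by
      unfold extDerivMatrix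
      rw [fderiv_fun_sub (((hT' _ _).contDiffAt (hU.mem_nhds hx)).differentiableAt one_ne_zero)
        (((hT' _ _).contDiffAt (hU.mem_nhds hx)).differentiableAt one_ne_zero)]
      rfl
    have hdη (b c d a : Fin 4) : fderiv ℝ (η b c d) x (stdFrame a) =
        (fderiv ℝ (T b) x (stdFrame a) * extDerivMatrix T x c d
          + T b x * fderiv ℝ (fun z ↦ extDerivMatrix T z c d) x (stdFrame a))
        - (fderiv ℝ (T c) x (stdFrame a) * extDerivMatrix T x b d
          + T c x * fderiv ℝ (fun z ↦ extDerivMatrix T z b d) x (stdFrame a))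
        + (fderiv ℝ (T d) x (stdFrame a) * extDerivMatrix T x b c
          + T d x * fderiv ℝ (fun z ↦ extDerivMatrix T z b c) x (stdFrame a)) := by
      have dT (b) :=
        (((hT1 b).contDiffAt (hU.mem_nhds hx)).differentiableAt one_ne_zero).hasFDerivAt
      have dα (b c) :=
        (((hα b c).contDiffAt (hU.mem_nhds hx)).differentiableAt one_ne_zero).hasFDerivAt
      have dm (a b c) := (dT a).fun_mul (dα b c)
      rw [(((dm b c d).fun_sub (dm c b d)).fun_add (dm d b c)).fderiv]
      simp
      ring
    simp only [fderiv_mul_mul hU hs hF (hη _ _ _) hx, hdη, hdα]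
    rw [hsymm 1 2 0, hsymm 1 3 0, hsymm 2 1 0, hsymm 2 3 0, hsymm 3 1 0, hsymm 3 2 0,
      hsymm 2 0 1, hsymm 2 3 1, hsymm 3 0 1, hsymm 3 2 1, hsymm 3 0 2, hsymm 3 1 2]
    simp only [η, wedgeCoeff, extDerivMatrix, diffWedgeMatrix]
    ring
  · intro x hx
    have hz (w : EuclideanSpace ℝ (Fin 4) → ℝ) : fderiv ℝ (fun x ↦ s x * (F x * w x)) x = 0 := by
      have : (fun x ↦ s x * (F x * w x)) =ᶠ[nhds x] fun _ ↦ 0 := by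
        filter_upwards [notMem_tsupport_iff_eventuallyEq.1 fun h ↦ hx (hFU h)] with z hz
        simp [hz]
      rw [this.fderiv_eq]; simp
    simp [hz]

end EuclideanStokes

/-! ### Coordinate vector fields and their change between charts -/

section Coordinates

open VectorField

variable {E : Type*} [NormedAddCommGroup E] [NormedSpace ℝ E]
  {H : Type*} [TopologicalSpace H] (I : ModelWithCorners ℝ E H)
  {M : Type*} [TopologicalSpace M] [ChartedSpace H M]

/-- The inverse of the derivative of the chart at `p`. -/
def coordFrame (p y : M) : E →L[ℝ] TangentSpace I y :=
  (mfderiv I 𝓘(ℝ, E) (extChartAt I p) y).inverse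

/-- The vector field that is constant in the chart at `p`. -/
def coordField (p : M) (c : E) (y : M) : TangentSpace I y :=
  coordFrame I p y c

variable {I} [IsManifold I ∞ M]

/-- The constant vector field on a normed space. -/
def constField (c : E) (x : E) : TangentSpace 𝓘(ℝ, E) x := c

theorem contMDiffAt_constField (c x : E) : CMDiffAt ∞ (T% (constField c)) x :=
  contMDiffAt_vectorSpace_iff_contDiffAt.2 contDiffAt_const

theorem mlieBracket_constField (c d : E) :
    mlieBracket 𝓘(ℝ, E) (constField c) (constField d) = 0 := by
  rw [← mlieBracketWithin_univ, mlieBracketWithin_eq_lieBracketWithin]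
  have h (c x : E) : fderivWithin ℝ (fun _ : E ↦ c) Set.univ x = 0 := by simp
  funext x
  change fderivWithin ℝ (fun _ : E ↦ d) Set.univ x c - fderivWithin ℝ (fun _ : E ↦ c) Set.univ x d
    = (0 : E)
  simp [h]

theorem contMDiffAt_coordField [CompleteSpace E] {p y : M} (hy : y ∈ (extChartAt I p).source) (c : E) :
    CMDiffAt ∞ (T% (coordField I p c)) y :=
  ContMDiffAt.mpullback_vectorField_preimage (n := ∞) (contMDiffAt_constField c _)
    (contMDiffAt_extChartAt' (by simpa using hy)) (isInvertible_mfderiv_extChartAt hy) (by simp)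

theorem mfderiv_coordField {p y : M} (hy : y ∈ (extChartAt I p).source)
    (c : E) :
    mfderiv I 𝓘(ℝ, E) (extChartAt I p) y (coordField I p c y) = c :=
  (isInvertible_mfderiv_extChartAt hy).self_apply_inverse _

/-- Brackets commute with pullback, and constant fields commute. Hence dθ on coordinate fields has
no bracket term. -/
theorem mlieBracket_coordField [CompleteSpace E] {p y : M} (hy : y ∈ (extChartAt I p).source) (c d : E) :
    mlieBracket I (coordField I p c) (coordField I p d) y = 0 := by
  have : IsManifold I (minSmoothness ℝ 2) M := by
    rw [minSmoothness_of_isRCLikeNormedField]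
    infer_instance
  have h := mpullback_mlieBracket (n := ∞)
    ((contMDiffAt_constField c (extChartAt I p y)).mdifferentiableAt (by simp))
    ((contMDiffAt_constField d (extChartAt I p y)).mdifferentiableAt (by simp))
    (contMDiffAt_extChartAt' (I := I) (by simpa using hy)) (by simp; norm_cast)
  refine h.symm.trans ?_
  rw [mlieBracket_constField]
  simp

variable {F : Type*} [NormedAddCommGroup F] [NormedSpace ℝ F]

variable [I.Boundaryless]

theorem differentiableAt_comp_symm {p y : M} (hy : y ∈ (extChartAt I p).source) {h : M → F}
    (hh : MDiffAt h y) :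
    DifferentiableAt ℝ (h ∘ (extChartAt I p).symm) (extChartAt I p y) := by
  have h1 := mdifferentiableWithinAt_extChartAt_symm (I := I) (x := p)
    ((extChartAt I p).map_source hy)
  rw [I.range_eq_univ, mdifferentiableWithinAt_univ] at h1
  rw [← mdifferentiableAt_iff_differentiableAt]
  refine MDifferentiableAt.comp _ ?_ h1
  rwa [(extChartAt I p).left_inv hy]

theorem mfderiv_eq_fderiv_comp {p y : M} (hy : y ∈ (extChartAt I p).source) {h : M → F}
    (hh : MDiffAt h y) (w : TangentSpace I y) :
    d% h y w = fderiv ℝ (h ∘ (extChartAt I p).symm) (extChartAt I p y)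
      (mfderiv I 𝓘(ℝ, E) (extChartAt I p) y w) := by
  have h2 := (differentiableAt_comp_symm hy hh).mdifferentiableAt
  have h3 : MDiffAt (extChartAt I p) y := mdifferentiableAt_extChartAt (by simpa using hy)
  have h4 : (h ∘ (extChartAt I p).symm) ∘ extChartAt I p =ᶠ[nhds y] h := by
    filter_upwards [extChartAt_source_mem_nhds' (I := I) hy] with z hz
    simp only [Function.comp_apply]
    rw [(extChartAt I p).left_inv hz]
  have h5 := mfderiv_comp y h2 h3
  rw [h4.mfderiv_eq, mfderiv_eq_fderiv] at h5
  exact congrArg (fun L ↦ L w) h5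

theorem mvfderiv_coordField {p y : M} (hy : y ∈ (extChartAt I p).source) {h : M → ℝ}
    (hh : MDiffAt h y) (c : E) :
    d% h y (coordField I p c y) =
      fderiv ℝ (h ∘ (extChartAt I p).symm) (extChartAt I p y) c := by
  rw [mfderiv_eq_fderiv_comp hy hh, mfderiv_coordField hy]

variable (I) in
/-- The determinant of the coordinate frame of the chart at `p`. -/
def coordDet (p y : M) : ℝ :=
  (coordFrame I p y : E →L[ℝ] E).det

theorem differentiableAt_transition {p q y : M} (hp : y ∈ (extChartAt I p).source)
    (hq : y ∈ (extChartAt I q).source) :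
    DifferentiableAt ℝ (extChartAt I q ∘ (extChartAt I p).symm)
      (extChartAt I p y) :=
  differentiableAt_comp_symm hp (mdifferentiableAt_extChartAt (I := I) (by simpa using hq))

theorem coordFrame_transition {p q y : M} (hp : y ∈ (extChartAt I p).source)
    (hq : y ∈ (extChartAt I q).source) (c : E) :
    coordFrame I p y c = coordFrame I q y (fderiv ℝ (extChartAt I q ∘ (extChartAt I p).symm)
      (extChartAt I p y) c) := by
  have h := mfderiv_eq_fderiv_comp hp (h := extChartAt I q)
    (mdifferentiableAt_extChartAt (I := I) (by simpa using hq)) (coordField I p c y)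
  rw [mfderiv_coordField hp] at h
  rw [← h]
  exact ((isInvertible_mfderiv_extChartAt hq).inverse_apply_self _).symm

/-- The chain rule for determinants; the extra factor is the Jacobian needed in the change of
variables of `chartIntegral_eq`. -/
theorem coordDet_transition {p q y : M} (hp : y ∈ (extChartAt I p).source)
    (hq : y ∈ (extChartAt I q).source) :
    coordDet I p y = coordDet I q y *
      (fderiv ℝ (extChartAt I q ∘ (extChartAt I p).symm) (extChartAt I p y)).det := by
  have h : (coordFrame I p y : E →L[ℝ] E) =
      (coordFrame I q y : E →L[ℝ] E).comp
      (fderiv ℝ (extChartAt I q ∘ (extChartAt I p).symm) (extChartAt I p y)) :=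
    ContinuousLinearMap.ext fun c ↦ coordFrame_transition hp hq c
  rw [coordDet, h, coordDet]
  exact LinearMap.det_comp _ _

omit [I.Boundaryless] in
theorem coordDet_ne_zero {p y : M} (hp : y ∈ (extChartAt I p).source) :
    coordDet I p y ≠ 0 := by
  have h : (mfderiv I 𝓘(ℝ, E) (extChartAt I p) y :
      E →L[ℝ] E).comp
      (coordFrame I p y : E →L[ℝ] E) =
      ContinuousLinearMap.id ℝ _ :=
    ContinuousLinearMap.ext fun c ↦ mfderiv_coordField hp c
  intro h0
  have h2 := LinearMap.det_comp (mfderiv I 𝓘(ℝ, E) (extChartAt I p) y : E →L[ℝ] E).toLinearMap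
      (coordFrame I p y : E →L[ℝ] E).toLinearMap
  refine one_ne_zero (α := ℝ) (Eq.trans ?_ (h2.trans ?_))
  · rw [← LinearMap.det_id (M := E)]
    exact congrArg (fun L : E →L[ℝ] E ↦ LinearMap.det L.toLinearMap) h.symm
  · exact (congrArg _ h0).trans (mul_zero _)

end Coordinates

/-! ### The two-form g([J, ∇v]·, ·) of a Killing field -/

section KillingForm

open VectorField

variable {E : Type*} [NormedAddCommGroup E] [NormedSpace ℝ E]
  {H : Type*} [TopologicalSpace H] {I : ModelWithCorners ℝ E H}
  {M : Type*} [TopologicalSpace M] [ChartedSpace H M] [IsManifold I ∞ M]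
  {g : Metric I M} {J : AlmostComplex I M} {v : Π y : M, TangentSpace I y}
  {D : CovariantDerivative I E (TangentSpace I : M → Type _)}

theorem AlmostComplex.mdifferentiableAt_apply (J : AlmostComplex I M) {x : M}
    {X : Π y : M, TangentSpace I y} (hX : MDiffAt (T% X) x) :
    MDiffAt (T% (fun y ↦ J.val y (X y))) x :=
  ((J.contMDiff x).mdifferentiableAt (by simp)).clm_bundle_apply hX

theorem AlmostComplex.contMDiffAt_apply (J : AlmostComplex I M) {x : M}
    {X : Π y : M, TangentSpace I y} (hX : CMDiffAt ∞ (T% X) x) :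
    CMDiffAt ∞ (T% (fun y ↦ J.val y (X y))) x :=
  (J.contMDiff x).clm_bundle_apply hX

theorem Metric.contMDiffAt_apply (g : Metric I M) {x : M}
    {X Y : Π y : M, TangentSpace I y} (hX : CMDiffAt ∞ (T% X) x) (hY : CMDiffAt ∞ (T% Y) x) :
    CMDiffAt ∞ (fun y ↦ g.val y (X y) (Y y)) x := by
  have h : ContMDiffAt I (I.prod 𝓘(ℝ, ℝ)) ∞
      (fun m ↦ TotalSpace.mk' ℝ (E := Bundle.Trivial M ℝ) m (g.val m (X m) (Y m))) x := by
    apply ContMDiffAt.clm_bundle_apply₂ (F₁ := E) (F₂ := E) (g.contMDiff x) hX hY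
  exact (contMDiffAt_totalSpace.1 h).2

/-- The one-form `g(J v, ·)`. -/
def kahlerOneForm (g : Metric I M) (J : AlmostComplex I M) (v : Π y : M, TangentSpace I y)
    (y : M) : TangentSpace I y →L[ℝ] ℝ :=
  g.val y (J.val y (v y))

/-- The two-form `g([J, ∇v] ·, ·)`. -/
def commutatorForm (g : Metric I M) (J : AlmostComplex I M)
    (D : CovariantDerivative I E (TangentSpace I : M → Type _)) (v : Π y : M, TangentSpace I y)
    (y : M) : TangentSpace I y →L[ℝ] TangentSpace I y →L[ℝ] ℝ :=
  (g.val y).comp ((J.val y).comp (D v y) - (D v y).comp (J.val y))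

theorem commutatorForm_apply (y : M) (u w : TangentSpace I y) :
    commutatorForm g J D v y u w = g.val y (J.val y (D v y u) - D v y (J.val y u)) w := rfl

theorem isometry_skew (hJ : ∀ (x : M) (u w : TangentSpace I x),
    g.val x (J.val x u) (J.val x w) = g.val x u w) (x : M) (u w : TangentSpace I x) :
    g.val x (J.val x u) w = -g.val x u (J.val x w) := by
  rw [← hJ x u (J.val x w), J.sq, map_neg, neg_neg]

variable [FiniteDimensional ℝ E]

/-- Metric compatibility and zero torsion turn (£_v g)(X, Y) into g(∇_X v, Y) + g(X, ∇_Y v). Single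
tangent vectors are extended to fields differentiable at x. -/
theorem IsKilling.covariantDerivative_skew (hv : IsKilling g v) (hD : IsLeviCivita g D) (x : M)
    (u w : TangentSpace I x) : g.val x (D v x u) w = -g.val x u (D v x w) := by
  have hu := FiberBundle.mdifferentiableAt_extend I E u
  have hw := FiberBundle.mdifferentiableAt_extend I E w
  have hv' : MDiffAt (T% v) x := (hv.contMDiff x).mdifferentiableAt (by simp)
  have h := hv.lieDeriv_eq_zero x _ _ hu hw
  rw [lieDerivMetric, hD.metric x _ _ (v x) hu hw, ← hD.torsion_free x _ _ hv' hu,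
    ← hD.torsion_free x _ _ hv' hw] at h
  simp only [FiberBundle.extend_apply_self, map_sub, sub_apply] at h
  linarith

theorem lieDerivComplex_eq (hv : MDiff (T% v)) (hD : IsLeviCivita g D)
    (hJ : IsParallel D J) {x : M} {X : Π y : M, TangentSpace I y} (hX : MDiffAt (T% X) x) :
    lieDerivComplex v J X x = J.val x (D v x (X x)) - D v x (J.val x (X x)) := by
  rw [lieDerivComplex, ← hD.torsion_free x v X (hv x) hX,
    ← hD.torsion_free x v (fun y ↦ J.val y (X y)) (hv x) (J.mdifferentiableAt_apply hX),
    hJ x X _ hX, map_sub]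
  abel

/-- With [X, Y] = 0 the terms in ∇_X Y and ∇_Y X cancel, so dθ(X, Y) = g(J∇_X v, Y) - g(J∇_Y v, X).
Skewness of J and then of ∇v rewrites the second term as -g(∇_{JX} v, Y). -/
theorem extDeriv_kahlerOneForm (hgJ : ∀ (x : M) (u w : TangentSpace I x),
    g.val x (J.val x u) (J.val x w) = g.val x u w) (hv : IsKilling g v) (hD : IsLeviCivita g D)
    (hJ : IsParallel D J) {x : M} {X Y : Π y : M, TangentSpace I y} (hX : MDiffAt (T% X) x)
    (hY : MDiffAt (T% Y) x) (hXY : mlieBracket I X Y x = 0) :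
    commutatorForm g J D v x (X x) (Y x) =
      d% (fun y ↦ kahlerOneForm g J v y (Y y)) x (X x)
        - d% (fun y ↦ kahlerOneForm g J v y (X y)) x (Y x) := by
  have hv' : MDiffAt (T% v) x := (hv.contMDiff x).mdifferentiableAt (by simp)
  have hJv := J.mdifferentiableAt_apply hv'
  have h1 := hD.torsion_free x X Y hX hY
  rw [hXY, sub_eq_zero] at h1
  simp only [kahlerOneForm]
  rw [hD.metric x _ Y (X x) hJv hY, hD.metric x _ X (Y x) hJv hX, hJ x v _ hv', hJ x v _ hv', h1,
    commutatorForm_apply, map_sub, sub_apply,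
    isometry_skew hgJ x (D v x (Y x)) (X x), g.symm x _ (J.val x (X x)),
    hv.covariantDerivative_skew hD x (J.val x (X x))]
  ring

/-- The commutator of two g-skew endomorphisms is g-skew. -/
theorem commutatorForm_skew (hgJ : ∀ (x : M) (u w : TangentSpace I x),
    g.val x (J.val x u) (J.val x w) = g.val x u w) (hv : IsKilling g v) (hD : IsLeviCivita g D)
    (x : M) (u w : TangentSpace I x) :
    commutatorForm g J D v x u w = -commutatorForm g J D v x w u := by
  have hA := hv.covariantDerivative_skew hD x
  have hS := isometry_skew hgJ x
  simp only [commutatorForm_apply, map_sub, sub_apply]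
  rw [hS, hA, hA (J.val x u), hS u, g.symm x _ u, g.symm x _ u]
  ring

-- As J² = -1, the commutator [J, ∇v] anticommutes with J; moving J across g changes the sign once
-- more.
omit [FiniteDimensional ℝ E] in
theorem commutatorForm_complex (hgJ : ∀ (x : M) (u w : TangentSpace I x),
    g.val x (J.val x u) (J.val x w) = g.val x u w) (x : M) (u w : TangentSpace I x) :
    commutatorForm g J D v x (J.val x u) w = commutatorForm g J D v x u (J.val x w) := by
  simp only [commutatorForm_apply, J.sq, map_neg, sub_neg_eq_add]
  rw [map_add, map_sub, add_apply, sub_apply, hgJ, isometry_skew hgJ]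
  have := isometry_skew hgJ x (D v x (J.val x u)) w
  linarith

theorem isRealHolomorphic_of_commutatorForm_eq_zero (hv : IsKilling g v) (hD : IsLeviCivita g D)
    (hJ : IsParallel D J) (h : ∀ x, commutatorForm g J D v x = 0) : IsRealHolomorphic J v where
  contMDiff := hv.contMDiff
  lieDeriv_eq_zero x X hX := by
    rw [lieDerivComplex_eq (fun y ↦ (hv.contMDiff y).mdifferentiableAt (by simp)) hD hJ hX]
    refine g.nondegenerate x _ fun w ↦ ?_
    rw [← commutatorForm_apply, h]
    rfl

end KillingForm

/-! ### Components of vector fields in a chart -/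

section CoordinateRepresentation

variable {E : Type*} [NormedAddCommGroup E] [NormedSpace ℝ E]
  {H : Type*} [TopologicalSpace H] {I : ModelWithCorners ℝ E H}
  {M : Type*} [TopologicalSpace M] [ChartedSpace H M] [IsManifold I ∞ M]

variable (I) in
/-- The derivative of the chart at `p`, with values in the model space. -/
def coordCoframe (p y : M) : TangentSpace I y →L[ℝ] E :=
  mfderiv I 𝓘(ℝ, E) (extChartAt I p) y

theorem coordCoframe_coordFrame {p y : M} (hy : y ∈ (extChartAt I p).source) (c : E) :
    coordCoframe I p y (coordFrame I p y c) = c :=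
  mfderiv_coordField hy c

theorem coordFrame_coordCoframe {p y : M} (hy : y ∈ (extChartAt I p).source)
    (w : TangentSpace I y) : coordFrame I p y (coordCoframe I p y w) = w :=
  (isInvertible_mfderiv_extChartAt hy).inverse_apply_self w

/-- On the chart domain the derivative of the chart at p is the fibre coordinate of the tangent
bundle trivialization at p, where smoothness of a section is read off. -/
theorem contMDiffAt_coordCoframe {p y : M} (hy : y ∈ (extChartAt I p).source)
    {X : Π y : M, TangentSpace I y} (hX : CMDiffAt ∞ (T% X) y) :
    ContMDiffAt I 𝓘(ℝ, E) ∞ (fun z ↦ coordCoframe I p z (X z)) y := by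
  have hy' : y ∈ (chartAt H p).source := by simpa using hy
  have h := ((trivializationAt E (TangentSpace I) p).contMDiffAt_section_iff
    (by simpa using hy')).1 hX
  refine h.congr_of_eventuallyEq ?_
  filter_upwards [(chartAt H p).open_source.mem_nhds hy'] with z hz
  rw [coordCoframe]
  have h2 := congrArg (fun L : TangentSpace I z →L[ℝ] E ↦ L (X z))
    (TangentBundle.continuousLinearMapAt_trivializationAt (I := I) (𝕜 := ℝ) hz)
  refine Eq.trans h2.symm ?_
  rw [Trivialization.continuousLinearMapAt_apply, Trivialization.linearMapAt_apply]
  simp [hz]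

end CoordinateRepresentation

/-! ### Four-forms and the orientation of J in charts -/

section ChartDensity

variable {M : Type*} [TopologicalSpace M] [ChartedSpace (EuclideanSpace ℝ (Fin 4)) M]

/-- The square of a two-form, compared with the standard volume form of the model space. -/
def topDensity (α : Π y : M, TangentSpace (𝓡 4) y →L[ℝ] TangentSpace (𝓡 4) y →L[ℝ] ℝ) (y : M) : ℝ :=
  wedgeCoeff (fun a b ↦ α y (stdFrame a) (stdFrame b)) (fun a b ↦ α y (stdFrame a) (stdFrame b))

/-- The wedge product of two one-forms. -/
def wedgeOneForms {E : Type*} [NormedAddCommGroup E] [NormedSpace ℝ E] (β γ : E →L[ℝ] ℝ) :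
    E →L[ℝ] E →L[ℝ] ℝ :=
  β.smulRight γ - γ.smulRight β

theorem wedgeOneForms_apply {E : Type*} [NormedAddCommGroup E] [NormedSpace ℝ E]
    (β γ : E →L[ℝ] ℝ) (x y : E) : wedgeOneForms β γ x y = β x * γ y - β y * γ x := by
  simp [wedgeOneForms, mul_comm]

theorem wedgeOneForms_skew {E : Type*} [NormedAddCommGroup E] [NormedSpace ℝ E]
    (β γ : E →L[ℝ] ℝ) (x y : E) : wedgeOneForms β γ x y = -wedgeOneForms β γ y x := by
  rw [wedgeOneForms_apply, wedgeOneForms_apply]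
  ring

theorem wedgeOneForms_zero {E : Type*} [NormedAddCommGroup E] [NormedSpace ℝ E]
    (γ : E →L[ℝ] ℝ) : wedgeOneForms 0 γ = 0 := by
  ext x y
  simp [wedgeOneForms_apply]

theorem wedgeOneForms_add {E : Type*} [NormedAddCommGroup E] [NormedSpace ℝ E]
    (β β' γ : E →L[ℝ] ℝ) :
    wedgeOneForms (β + β') γ = wedgeOneForms β γ + wedgeOneForms β' γ := by
  ext x y
  simp only [add_apply, wedgeOneForms_apply]
  ring

theorem wedgeCoeff_add (a a' b : Fin 4 → Fin 4 → ℝ) :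
    wedgeCoeff (fun i j ↦ a i j + a' i j) b = wedgeCoeff a b + wedgeCoeff a' b := by
  simp only [wedgeCoeff]
  ring

/-- The four-form `df ∧ θ ∧ α`, compared with the standard volume form of the model space. -/
def diffDensity (f : M → ℝ) (θ : Π y : M, TangentSpace (𝓡 4) y →L[ℝ] ℝ)
    (α : Π y : M, TangentSpace (𝓡 4) y →L[ℝ] TangentSpace (𝓡 4) y →L[ℝ] ℝ) (y : M) : ℝ :=
  wedgeCoeff
    (fun a b ↦ wedgeOneForms (E := EuclideanSpace ℝ (Fin 4)) (mvfderiv (𝓡 4) f y) (θ y) (stdFrame a) (stdFrame b))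
    (fun a b ↦ α y (stdFrame a) (stdFrame b))

variable [IsManifold (𝓡 4) ∞ M]

/-- The sign of the orientation given by `J` with respect to the standard volume form of the model
space. -/
def AlmostComplex.orientation (J : AlmostComplex (𝓡 4) M) (y : M) : ℝ :=
  orientationSign (J.val y : EuclideanSpace ℝ (Fin 4) →L[ℝ] EuclideanSpace ℝ (Fin 4))

/-- The sign of the orientation given by `J` in the chart at `p`. -/
def AlmostComplex.chartSign (J : AlmostComplex (𝓡 4) M) (p y : M) : ℝ :=
  SignType.sign (coordDet (𝓡 4) p y) * J.orientation y

/-- The matrix of `J` in the chart at `p`. -/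
def AlmostComplex.inChart (J : AlmostComplex (𝓡 4) M) (p y : M) :
    EuclideanSpace ℝ (Fin 4) →L[ℝ] EuclideanSpace ℝ (Fin 4) :=
  (coordCoframe (𝓡 4) p y).comp ((J.val y).comp (coordFrame (𝓡 4) p y))

variable (J : AlmostComplex (𝓡 4) M) {p y : M}

theorem AlmostComplex.coordFrame_inChart (hy : y ∈ (extChartAt (𝓡 4) p).source)
    (c : EuclideanSpace ℝ (Fin 4)) :
    coordFrame (𝓡 4) p y (J.inChart p y c) = J.val y (coordFrame (𝓡 4) p y c) :=
  coordFrame_coordCoframe hy _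

theorem AlmostComplex.inChart_sq (hy : y ∈ (extChartAt (𝓡 4) p).source)
    (c : EuclideanSpace ℝ (Fin 4)) : J.inChart p y (J.inChart p y c) = -c := by
  have h : J.inChart p y (J.inChart p y c) =
    coordCoframe (𝓡 4) p y (J.val y (coordFrame (𝓡 4) p y (J.inChart p y c))) := rfl
  rw [h, J.coordFrame_inChart hy, J.sq, map_neg, coordCoframe_coordFrame hy]

theorem AlmostComplex.continuousAt_inChart (hy : y ∈ (extChartAt (𝓡 4) p).source)
    (c : EuclideanSpace ℝ (Fin 4)) : ContinuousAt (fun z ↦ J.inChart p z c) y :=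
  (contMDiffAt_coordCoframe hy (J.contMDiffAt_apply (contMDiffAt_coordField hy c))).continuousAt

/-- The coordinate frame carries complex frames of the chart matrix of J to complex frames of J and
multiplies determinants by `coordDet`. Its sign then occurs twice and drops out, leaving a quantity
that depends on the chart matrix alone. -/
theorem AlmostComplex.chartSign_eq (hy : y ∈ (extChartAt (𝓡 4) p).source)
    {e f : EuclideanSpace ℝ (Fin 4)}
    (hef : (frameMatrix (complexFrame (J.inChart p y) e f)).det ≠ 0) :
    J.chartSign p y = SignType.sign (frameMatrix (complexFrame (J.inChart p y) e f)).det := by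
  let L : EuclideanSpace ℝ (Fin 4) →L[ℝ] EuclideanSpace ℝ (Fin 4) := coordFrame (𝓡 4) p y
  let J' : EuclideanSpace ℝ (Fin 4) →L[ℝ] EuclideanSpace ℝ (Fin 4) := J.val y
  have hJ' : ∀ x, J' (J' x) = -x := J.sq y
  have hfr : complexFrame J' (L e) (L f) = fun i ↦ L (complexFrame (J.inChart p y) e f i) := by
    funext i
    fin_cases i
    · rfl
    · exact (J.coordFrame_inChart hy e).symm
    · rfl
    · exact (J.coordFrame_inChart hy f).symm
  have hdet : (frameMatrix (complexFrame J' (L e) (L f))).det =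
      coordDet (𝓡 4) p y * (frameMatrix (complexFrame (J.inChart p y) e f)).det := by
    rw [hfr, frameMatrix_map, Matrix.det_mul, det_frameMatrix_stdFrame]
    rfl
  have hne : coordDet (𝓡 4) p y ≠ 0 := coordDet_ne_zero hy
  have h1 := orientationSign_eq hJ' (e := L e) (f := L f) (by rw [hdet]; exact mul_ne_zero hne hef)
  rw [AlmostComplex.chartSign, AlmostComplex.orientation]
  refine (congrArg _ h1).trans ?_
  rw [hdet, sign_mul, SignType.coe_mul, ← mul_assoc, ← SignType.coe_mul, ← sign_mul,
    sign_pos (mul_self_pos.2 hne)]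
  simp

/-- With e and f fixed, the determinant of the complex frame of the chart matrix is continuous and
nonzero at y, so it keeps its sign nearby. -/
theorem AlmostComplex.eventually_chartSign (hy : y ∈ (extChartAt (𝓡 4) p).source) :
    ∀ᶠ z in nhds y, J.chartSign p z = J.chartSign p y := by
  obtain ⟨e, f, hef⟩ := exists_det_complexFrame_ne_zero (J.inChart_sq hy)
  have hc (c : EuclideanSpace ℝ (Fin 4)) (i : Fin 4) : ContinuousAt (fun z ↦ J.inChart p z c i) y :=
    (EuclideanSpace.proj (𝕜 := ℝ) i).continuous.continuousAt.comp (J.continuousAt_inChart hy c)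
  have hcont : ContinuousAt
      (fun z ↦ (frameMatrix (complexFrame (J.inChart p z) e f)).det) y := by
    simp only [Matrix.det_apply]
    refine tendsto_finsetSum _ fun σ _ ↦ Filter.Tendsto.const_smul
      (tendsto_finsetProd _ fun i _ ↦ ?_) _
    fin_cases i
    · exact tendsto_const_nhds
    · exact hc e _
    · exact tendsto_const_nhds
    · exact hc f _
  have hev : ∀ᶠ z in nhds y,
      0 < (frameMatrix (complexFrame (J.inChart p z) e f)).det *
        (frameMatrix (complexFrame (J.inChart p y) e f)).det :=
    (hcont.mul continuousAt_const).eventually (lt_mem_nhds (mul_self_pos.2 hef))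
  filter_upwards [hev, extChartAt_source_mem_nhds' (I := 𝓡 4) hy] with z hz hzs
  rw [J.chartSign_eq hy hef, J.chartSign_eq hzs (left_ne_zero_of_mul hz.ne')]
  congr 1
  rcases pos_and_pos_or_neg_and_neg_of_mul_pos hz with h | h
  · rw [sign_pos h.1, sign_pos h.2]
  · rw [sign_neg h.1, sign_neg h.2]

variable {θ : Π y : M, TangentSpace (𝓡 4) y →L[ℝ] ℝ}
  {α : Π y : M, TangentSpace (𝓡 4) y →L[ℝ] TangentSpace (𝓡 4) y →L[ℝ] ℝ}

/-- The components of a one-form in the chart at `p`. -/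
def chartComponents (θ : Π y : M, TangentSpace (𝓡 4) y →L[ℝ] ℝ) (p : M) (b : Fin 4)
    (x : EuclideanSpace ℝ (Fin 4)) : ℝ :=
  θ ((extChartAt (𝓡 4) p).symm x) (coordField (𝓡 4) p (stdFrame b) ((extChartAt (𝓡 4) p).symm x))

/-- The two-form `α` is the exterior derivative of the smooth one-form `θ`. -/
structure IsExteriorDerivative (θ : Π y : M, TangentSpace (𝓡 4) y →L[ℝ] ℝ)
    (α : Π y : M, TangentSpace (𝓡 4) y →L[ℝ] TangentSpace (𝓡 4) y →L[ℝ] ℝ) : Prop where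
  contMDiffAt (p : M) (c : EuclideanSpace ℝ (Fin 4)) (y : M)
    (hy : y ∈ (extChartAt (𝓡 4) p).source) :
    ContMDiffAt (𝓡 4) 𝓘(ℝ, ℝ) ∞ (fun z ↦ θ z (coordField (𝓡 4) p c z)) y
  skew (y : M) (u w : TangentSpace (𝓡 4) y) : α y u w = -α y w u
  eq_extDeriv (p : M) (c d : EuclideanSpace ℝ (Fin 4)) (y : M)
    (hy : y ∈ (extChartAt (𝓡 4) p).source) :
    α y (coordField (𝓡 4) p c y) (coordField (𝓡 4) p d y) =
      mvfderiv (𝓡 4) (fun z ↦ θ z (coordField (𝓡 4) p d z)) y (coordField (𝓡 4) p c y)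
        - mvfderiv (𝓡 4) (fun z ↦ θ z (coordField (𝓡 4) p c z)) y (coordField (𝓡 4) p d y)

theorem IsExteriorDerivative.extDerivMatrix_eq (h : IsExteriorDerivative θ α)
    (hy : y ∈ (extChartAt (𝓡 4) p).source) :
    extDerivMatrix (chartComponents θ p) (extChartAt (𝓡 4) p y) = fun a b ↦
      α y (coordField (𝓡 4) p (stdFrame a) y) (coordField (𝓡 4) p (stdFrame b) y) := by
  funext a b
  have hd (c : EuclideanSpace ℝ (Fin 4)) := (h.contMDiffAt p c y hy).mdifferentiableAt (by simp)
  rw [h.eq_extDeriv p _ _ y hy, mvfderiv_coordField hy (hd _), mvfderiv_coordField hy (hd _)]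
  rfl

theorem IsExteriorDerivative.contDiffOn_chartComponents (h : IsExteriorDerivative θ α) (p : M)
    (b : Fin 4) : ContDiffOn ℝ ∞ (chartComponents θ p b) (extChartAt (𝓡 4) p).target := by
  rw [← contMDiffOn_iff_contDiffOn]
  intro x hx
  have h1 := contMDiffOn_extChartAt_symm (I := 𝓡 4) (n := ∞) p x hx
  exact (h.contMDiffAt p (stdFrame b) _ ((extChartAt (𝓡 4) p).map_target hx)).comp_contMDiffWithinAt
    x h1

/-- This trades the absolute value required of a density for the chart coefficient of a four-form
times a locally constant sign, the form in which Euclidean Stokes applies. -/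
theorem abs_coordDet_mul (m : ℝ) :
    |coordDet (𝓡 4) p y| * (J.orientation y * m) =
      J.chartSign p y * (coordDet (𝓡 4) p y * m) := by
  rw [AlmostComplex.chartSign, ← sign_mul_self]
  ring

omit [IsManifold (𝓡 4) ∞ M] in
theorem wedgeCoeff_coordField (p y : M)
    (α β : TangentSpace (𝓡 4) y →L[ℝ] TangentSpace (𝓡 4) y →L[ℝ] ℝ)
    (hα : ∀ x y, α x y = -α y x) (hβ : ∀ x y, β x y = -β y x) :
    wedgeCoeff (fun a b ↦ α (coordField (𝓡 4) p (stdFrame a) y) (coordField (𝓡 4) p (stdFrame b) y))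
      (fun a b ↦ β (coordField (𝓡 4) p (stdFrame a) y) (coordField (𝓡 4) p (stdFrame b) y)) =
    coordDet (𝓡 4) p y * wedgeCoeff (fun a b ↦ α (stdFrame a) (stdFrame b))
      (fun a b ↦ β (stdFrame a) (stdFrame b)) := by
  refine (wedgeCoeff_frame (α : EuclideanSpace ℝ (Fin 4) →L[ℝ] EuclideanSpace ℝ (Fin 4) →L[ℝ] ℝ)
    β hα hβ (fun a ↦ coordField (𝓡 4) p (stdFrame a) y)).trans ?_
  congr 1
  exact det_frameMatrix_stdFrame
    (coordFrame (𝓡 4) p y : EuclideanSpace ℝ (Fin 4) →L[ℝ] EuclideanSpace ℝ (Fin 4))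

theorem IsExteriorDerivative.topDensity_chart (h : IsExteriorDerivative θ α)
    (hy : y ∈ (extChartAt (𝓡 4) p).source) :
    coordDet (𝓡 4) p y * topDensity α y =
      wedgeCoeff (extDerivMatrix (chartComponents θ p) (extChartAt (𝓡 4) p y))
        (extDerivMatrix (chartComponents θ p) (extChartAt (𝓡 4) p y)) := by
  rw [h.extDerivMatrix_eq hy]
  exact (wedgeCoeff_coordField p y (α y) (α y) (h.skew y) (h.skew y)).symm

theorem IsExteriorDerivative.diffDensity_chart (h : IsExteriorDerivative θ α)
    (hy : y ∈ (extChartAt (𝓡 4) p).source) {f : M → ℝ} (hf : MDifferentiableAt (𝓡 4) 𝓘(ℝ, ℝ) f y) :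
    coordDet (𝓡 4) p y * diffDensity f θ α y =
      wedgeCoeff (diffWedgeMatrix (f ∘ (extChartAt (𝓡 4) p).symm) (chartComponents θ p)
          (extChartAt (𝓡 4) p y))
        (extDerivMatrix (chartComponents θ p) (extChartAt (𝓡 4) p y)) := by
  rw [h.extDerivMatrix_eq hy]
  refine (wedgeCoeff_coordField p y
    (wedgeOneForms (E := EuclideanSpace ℝ (Fin 4)) (mvfderiv (𝓡 4) f y) (θ y)) (α y) ?_ (h.skew y)).symm.trans ?_
  · exact wedgeOneForms_skew (E := EuclideanSpace ℝ (Fin 4)) _ _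
  · congr 1
    funext a b
    refine (wedgeOneForms_apply (E := EuclideanSpace ℝ (Fin 4)) _ _ _ _).trans ?_
    rw [diffWedgeMatrix, ← mvfderiv_coordField hy hf, ← mvfderiv_coordField hy hf]
    have hθ (c : Fin 4) : chartComponents θ p c (extChartAt (𝓡 4) p y) =
        θ y (coordField (𝓡 4) p (stdFrame c) y) :=
      congrArg (fun z ↦ θ z (coordField (𝓡 4) p (stdFrame c) z)) ((extChartAt (𝓡 4) p).left_inv hy)
    rw [hθ, hθ]
    rfl

end ChartDensity

/-! ### Integration of densities over charts, and Stokes' theorem in a chart -/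

section ChartIntegral

open MeasureTheory

variable {M : Type*} [TopologicalSpace M] [ChartedSpace (EuclideanSpace ℝ (Fin 4)) M]

/-- The integral over the chart at `p` of a density, given at each point by its value on the
standard basis of the model space. -/
def chartIntegral (p : M) (m : M → ℝ) : ℝ :=
  ∫ x in (extChartAt (𝓡 4) p).target, |coordDet (𝓡 4) p ((extChartAt (𝓡 4) p).symm x)| *
    m ((extChartAt (𝓡 4) p).symm x)

/-- Integrability of a density over the chart at `p`. -/
def ChartIntegrable (p : M) (m : M → ℝ) : Prop :=
  IntegrableOn (fun x ↦ |coordDet (𝓡 4) p ((extChartAt (𝓡 4) p).symm x)| *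
    m ((extChartAt (𝓡 4) p).symm x)) (extChartAt (𝓡 4) p).target

theorem chartIntegral_add {p : M} {m n : M → ℝ} (hm : ChartIntegrable p m)
    (hn : ChartIntegrable p n) :
    chartIntegral p (fun y ↦ m y + n y) = chartIntegral p m + chartIntegral p n := by
  simp only [chartIntegral, mul_add]
  exact integral_add hm hn

theorem chartIntegral_sum {ι : Type*} (s : Finset ι) {p : M} {m : ι → M → ℝ}
    (hm : ∀ i ∈ s, ChartIntegrable p (m i)) :
    chartIntegral p (fun y ↦ ∑ i ∈ s, m i y) = ∑ i ∈ s, chartIntegral p (m i) := by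
  simp only [chartIntegral, Finset.mul_sum]
  exact integral_finsetSum s hm

variable [IsManifold (𝓡 4) ∞ M]

/-- Change of variables along the transition map: its Jacobian is absorbed by the ratio of the two
coordinate determinants. No measurability of m is required. -/
theorem chartIntegral_eq {p q : M} {m : M → ℝ}
    (hm : ∀ y, m y ≠ 0 → y ∈ (extChartAt (𝓡 4) p).source ∧ y ∈ (extChartAt (𝓡 4) q).source) :
    chartIntegral p m = chartIntegral q m := by
  let A (p q : M) : Set (EuclideanSpace ℝ (Fin 4)) :=
    (extChartAt (𝓡 4) p).target ∩ (extChartAt (𝓡 4) p).symm ⁻¹' (extChartAt (𝓡 4) q).source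
  have hA (p q : M) : IsOpen (A p q) :=
    (continuousOn_extChartAt_symm p).isOpen_inter_preimage (isOpen_extChartAt_target p)
      (isOpen_extChartAt_source q)
  have hres (p q : M) (hm : ∀ y, m y ≠ 0 → y ∈ (extChartAt (𝓡 4) q).source) : chartIntegral p m =
      ∫ x in A p q, |coordDet (𝓡 4) p ((extChartAt (𝓡 4) p).symm x)| *
        m ((extChartAt (𝓡 4) p).symm x) := by
    refine setIntegral_eq_of_subset_of_forall_sdiff_eq_zero
      (isOpen_extChartAt_target p).measurableSet Set.inter_subset_left ?_
    rintro x ⟨hx, hx'⟩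
    by_contra hne
    exact hx' ⟨hx, hm _ (right_ne_zero_of_mul hne)⟩
  rw [hres p q fun y hy ↦ (hm y hy).2, hres q p fun y hy ↦ (hm y hy).1]
  have himage : (extChartAt (𝓡 4) q ∘ (extChartAt (𝓡 4) p).symm) '' A p q = A q p := by
    ext x
    constructor
    · rintro ⟨z, ⟨hz, hz'⟩, rfl⟩
      refine ⟨(extChartAt (𝓡 4) q).map_source hz', ?_⟩
      simp only [Set.mem_preimage, Function.comp_apply]
      rw [(extChartAt (𝓡 4) q).left_inv hz']
      exact (extChartAt (𝓡 4) p).map_target hz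
    · rintro ⟨hx, hx'⟩
      refine ⟨extChartAt (𝓡 4) p ((extChartAt (𝓡 4) q).symm x),
        ⟨(extChartAt (𝓡 4) p).map_source hx', ?_⟩, ?_⟩
      · simp only [Set.mem_preimage]
        rw [(extChartAt (𝓡 4) p).left_inv hx']
        exact (extChartAt (𝓡 4) q).map_target hx
      · simp only [Function.comp_apply]
        rw [(extChartAt (𝓡 4) p).left_inv hx', (extChartAt (𝓡 4) q).right_inv hx]
  have hinj : Set.InjOn (extChartAt (𝓡 4) q ∘ (extChartAt (𝓡 4) p).symm) (A p q) :=
    (extChartAt (𝓡 4) q).injOn.comp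
      ((extChartAt (𝓡 4) p).symm.injOn.mono Set.inter_subset_left) fun x hx ↦ hx.2
  have hderiv (x) (hx : x ∈ A p q) : HasFDerivWithinAt
      (extChartAt (𝓡 4) q ∘ (extChartAt (𝓡 4) p).symm)
      (fderiv ℝ (extChartAt (𝓡 4) q ∘ (extChartAt (𝓡 4) p).symm) x) (A p q) x := by
    have h := differentiableAt_transition (I := 𝓡 4) ((extChartAt (𝓡 4) p).map_target hx.1) hx.2
    rw [(extChartAt (𝓡 4) p).right_inv hx.1] at h
    exact h.hasFDerivAt.hasFDerivWithinAt
  rw [← himage, integral_image_eq_integral_abs_det_fderiv_smul volume (hA p q).measurableSet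
    hderiv hinj]
  refine setIntegral_congr_fun (hA p q).measurableSet fun x hx ↦ ?_
  have h := coordDet_transition (I := 𝓡 4) ((extChartAt (𝓡 4) p).map_target hx.1) hx.2
  rw [(extChartAt (𝓡 4) p).right_inv hx.1] at h
  simp only [Function.comp_apply, smul_eq_mul]
  rw [(extChartAt (𝓡 4) q).left_inv hx.2, h, abs_mul]
  simp only [Function.comp_def]
  ring

section Extension

variable {p : M} {f : M → ℝ}

/-- A function on `M` in the chart at `p`, extended by zero. -/
def chartExtension (p : M) (f : M → ℝ) : EuclideanSpace ℝ (Fin 4) → ℝ :=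
  Set.indicator (extChartAt (𝓡 4) p).target (f ∘ (extChartAt (𝓡 4) p).symm)

omit [IsManifold (𝓡 4) ∞ M] in
theorem chartExtension_eventuallyEq {x : EuclideanSpace ℝ (Fin 4)}
    (hx : x ∈ (extChartAt (𝓡 4) p).target) :
    chartExtension p f =ᶠ[nhds x] f ∘ (extChartAt (𝓡 4) p).symm := by
  filter_upwards [(isOpen_extChartAt_target p).mem_nhds hx] with z hz
  exact Set.indicator_of_mem hz _

omit [IsManifold (𝓡 4) ∞ M] in
theorem isCompact_image_tsupport [CompactSpace M] (hf : tsupport f ⊆ (extChartAt (𝓡 4) p).source) :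
    IsCompact (extChartAt (𝓡 4) p '' tsupport f) :=
  (isClosed_tsupport f).isCompact.image_of_continuousOn ((continuousOn_extChartAt p).mono hf)

omit [IsManifold (𝓡 4) ∞ M] in
theorem mem_image_tsupport {x : EuclideanSpace ℝ (Fin 4)} (hx : x ∈ (extChartAt (𝓡 4) p).target)
    (h : (extChartAt (𝓡 4) p).symm x ∈ tsupport f) : x ∈ extChartAt (𝓡 4) p '' tsupport f :=
  ⟨_, h, (extChartAt (𝓡 4) p).right_inv hx⟩

omit [IsManifold (𝓡 4) ∞ M] in
theorem image_tsupport_subset (hf : tsupport f ⊆ (extChartAt (𝓡 4) p).source) :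
    extChartAt (𝓡 4) p '' tsupport f ⊆ (extChartAt (𝓡 4) p).target := by
  rintro _ ⟨y, hy, rfl⟩
  exact (extChartAt (𝓡 4) p).map_source (hf hy)

omit [IsManifold (𝓡 4) ∞ M] in
theorem tsupport_chartExtension_subset [CompactSpace M]
    (hf : tsupport f ⊆ (extChartAt (𝓡 4) p).source) :
    tsupport (chartExtension p f) ⊆ extChartAt (𝓡 4) p '' tsupport f := by
  refine closure_minimal (fun x hx ↦ ?_) (isCompact_image_tsupport hf).isClosed
  have hxt : x ∈ (extChartAt (𝓡 4) p).target := by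
    by_contra h
    exact hx (Set.indicator_of_notMem h _)
  refine mem_image_tsupport hxt (subset_tsupport f ?_)
  rw [Function.mem_support, chartExtension, Set.indicator_of_mem hxt] at hx
  exact hx

theorem contDiffAt_comp_symm (hf : ContMDiff (𝓡 4) 𝓘(ℝ, ℝ) ∞ f) {x : EuclideanSpace ℝ (Fin 4)}
    (hx : x ∈ (extChartAt (𝓡 4) p).target) :
    ContDiffAt ℝ ∞ (f ∘ (extChartAt (𝓡 4) p).symm) x := by
  rw [← contMDiffAt_iff_contDiffAt]
  exact (hf _).comp x ((contMDiffOn_extChartAt_symm p).contMDiffAt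
    ((isOpen_extChartAt_target p).mem_nhds hx))

theorem contDiffOn_comp_symm (hf : ContMDiff (𝓡 4) 𝓘(ℝ, ℝ) ∞ f) (p : M) :
    ContDiffOn ℝ ∞ (f ∘ (extChartAt (𝓡 4) p).symm) (extChartAt (𝓡 4) p).target :=
  fun _ hx ↦ (contDiffAt_comp_symm hf hx).contDiffWithinAt

theorem contDiff_chartExtension [CompactSpace M] (hf : ContMDiff (𝓡 4) 𝓘(ℝ, ℝ) ∞ f)
    (hfp : tsupport f ⊆ (extChartAt (𝓡 4) p).source) : ContDiff ℝ ∞ (chartExtension p f) := by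
  refine contDiff_iff_contDiffAt.2 fun x ↦ ?_
  by_cases hx : x ∈ (extChartAt (𝓡 4) p).target
  · exact (contDiffAt_comp_symm hf hx).congr_of_eventuallyEq (chartExtension_eventuallyEq hx)
  · refine (contDiffAt_const (c := (0 : ℝ))).congr_of_eventuallyEq
      (notMem_tsupport_iff_eventuallyEq.1 fun h ↦ hx ?_)
    exact image_tsupport_subset hfp (tsupport_chartExtension_subset hfp h)

omit [IsManifold (𝓡 4) ∞ M] in
-- The chart target may have infinite measure, but w lives on the compact image of the support of f.
theorem integrableOn_chart [CompactSpace M] (hfp : tsupport f ⊆ (extChartAt (𝓡 4) p).source)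
    {w : EuclideanSpace ℝ (Fin 4) → ℝ} (hw : ContinuousOn w (extChartAt (𝓡 4) p).target)
    (hwf : ∀ x ∈ (extChartAt (𝓡 4) p).target, (extChartAt (𝓡 4) p).symm x ∉ tsupport f → w x = 0) :
    IntegrableOn w (extChartAt (𝓡 4) p).target := by
  refine ((hw.mono (image_tsupport_subset hfp)).integrableOn_compact
    (isCompact_image_tsupport hfp)).of_forall_sdiff_eq_zero
      (isOpen_extChartAt_target p).measurableSet ?_
  rintro x ⟨hx, hx'⟩
  exact hwf x hx fun h ↦ hx' (mem_image_tsupport hx h)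

end Extension

section Stokes

variable (J : AlmostComplex (𝓡 4) M) {θ : Π y : M, TangentSpace (𝓡 4) y →L[ℝ] ℝ}
  {α : Π y : M, TangentSpace (𝓡 4) y →L[ℝ] TangentSpace (𝓡 4) y →L[ℝ] ℝ} {p : M} {f : M → ℝ}

theorem AlmostComplex.eventually_chartSign_symm (J : AlmostComplex (𝓡 4) M)
    {x : EuclideanSpace ℝ (Fin 4)} (hx : x ∈ (extChartAt (𝓡 4) p).target) :
    ∀ᶠ z in nhds x, J.chartSign p ((extChartAt (𝓡 4) p).symm z) =
      J.chartSign p ((extChartAt (𝓡 4) p).symm x) :=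
  (continuousAt_extChartAt_symm'' hx).eventually
    (J.eventually_chartSign ((extChartAt (𝓡 4) p).map_target hx))

theorem IsExteriorDerivative.continuousOn_extDerivMatrix (h : IsExteriorDerivative θ α) (p : M)
    (a b : Fin 4) : ContinuousOn (fun x ↦ extDerivMatrix (chartComponents θ p) x a b)
      (extChartAt (𝓡 4) p).target := by
  have hT (b : Fin 4) (e : EuclideanSpace ℝ (Fin 4)) : ContinuousOn
      (fun x ↦ fderiv ℝ (chartComponents θ p b) x e) (extChartAt (𝓡 4) p).target :=
    ((h.contDiffOn_chartComponents p b).continuousOn_fderiv_of_isOpen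
      (isOpen_extChartAt_target p) (by simp)).clm_apply continuousOn_const
  exact (hT b _).sub (hT a _)

theorem continuousOn_wedgeCoeff {U : Set (EuclideanSpace ℝ (Fin 4))}
    {a b : EuclideanSpace ℝ (Fin 4) → Fin 4 → Fin 4 → ℝ}
    (ha : ∀ i j, ContinuousOn (fun x ↦ a x i j) U) (hb : ∀ i j, ContinuousOn (fun x ↦ b x i j) U) :
    ContinuousOn (fun x ↦ wedgeCoeff (a x) (b x)) U := by
  unfold wedgeCoeff
  fun_prop

/-- The factors need not be continuous separately; regrouped, they are the locally constant sign of
J in the chart times a polynomial in derivatives of the components of θ. -/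
theorem IsExteriorDerivative.continuousOn_topDensity (h : IsExteriorDerivative θ α) (p : M) :
    ContinuousOn (fun x ↦ |coordDet (𝓡 4) p ((extChartAt (𝓡 4) p).symm x)| *
      (J.orientation ((extChartAt (𝓡 4) p).symm x) * topDensity α ((extChartAt (𝓡 4) p).symm x)))
      (extChartAt (𝓡 4) p).target := by
  have hs : ContinuousOn (fun x ↦ J.chartSign p ((extChartAt (𝓡 4) p).symm x))
      (extChartAt (𝓡 4) p).target := fun x hx ↦ by
    exact (tendsto_nhds_of_eventually_eq (J.eventually_chartSign_symm hx)).mono_left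
      nhdsWithin_le_nhds
  refine (hs.mul (continuousOn_wedgeCoeff (h.continuousOn_extDerivMatrix p)
    (h.continuousOn_extDerivMatrix p))).congr fun x hx ↦ ?_
  have hy := (extChartAt (𝓡 4) p).map_target hx
  rw [abs_coordDet_mul, h.topDensity_chart hy, (extChartAt (𝓡 4) p).right_inv hx]
  rfl

theorem IsExteriorDerivative.continuousOn_diffDensity (h : IsExteriorDerivative θ α) (p : M)
    (hf : ContMDiff (𝓡 4) 𝓘(ℝ, ℝ) ∞ f) :
    ContinuousOn (fun x ↦ |coordDet (𝓡 4) p ((extChartAt (𝓡 4) p).symm x)| *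
      (J.orientation ((extChartAt (𝓡 4) p).symm x) *
        diffDensity f θ α ((extChartAt (𝓡 4) p).symm x)))
      (extChartAt (𝓡 4) p).target := by
  have hs : ContinuousOn (fun x ↦ J.chartSign p ((extChartAt (𝓡 4) p).symm x))
      (extChartAt (𝓡 4) p).target := fun x hx ↦ by
    exact (tendsto_nhds_of_eventually_eq (J.eventually_chartSign_symm hx)).mono_left
      nhdsWithin_le_nhds
  have hf' (e : EuclideanSpace ℝ (Fin 4)) : ContinuousOn
      (fun x ↦ fderiv ℝ (f ∘ (extChartAt (𝓡 4) p).symm) x e) (extChartAt (𝓡 4) p).target :=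
    ((contDiffOn_comp_symm hf p).continuousOn_fderiv_of_isOpen
      (isOpen_extChartAt_target p) (by simp)).clm_apply continuousOn_const
  have hT (b : Fin 4) := (h.contDiffOn_chartComponents p b).continuousOn
  refine (hs.mul (continuousOn_wedgeCoeff (a := fun x ↦ diffWedgeMatrix
    (f ∘ (extChartAt (𝓡 4) p).symm) (chartComponents θ p) x)
    (fun a b ↦ ((hf' _).mul (hT b)).sub ((hf' _).mul (hT a)))
    (h.continuousOn_extDerivMatrix p))).congr fun x hx ↦ ?_
  have hy := (extChartAt (𝓡 4) p).map_target hx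
  rw [abs_coordDet_mul, h.diffDensity_chart hy ((hf _).mdifferentiableAt (by simp)),
    (extChartAt (𝓡 4) p).right_inv hx]
  rfl

omit [IsManifold (𝓡 4) ∞ M] in
theorem diffDensity_eq_zero {y : M} (hf : mvfderiv (𝓡 4) f y = 0) : diffDensity f θ α y = 0 := by
  have h : wedgeOneForms (E := EuclideanSpace ℝ (Fin 4)) (mvfderiv (𝓡 4) f y) (θ y) = 0 :=
    (congrArg (fun β : EuclideanSpace ℝ (Fin 4) →L[ℝ] ℝ ↦ wedgeOneForms β (θ y)) hf).trans
      (wedgeOneForms_zero _)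
  refine (congrArg (fun β : EuclideanSpace ℝ (Fin 4) →L[ℝ] EuclideanSpace ℝ (Fin 4) →L[ℝ] ℝ ↦
    wedgeCoeff (fun a b ↦ β (stdFrame a) (stdFrame b))
      (fun a b ↦ α y (stdFrame a) (stdFrame b))) h).trans ?_
  simp [wedgeCoeff]

omit [IsManifold (𝓡 4) ∞ M] in
theorem diffDensity_eq_zero_of_notMem_tsupport {y : M} (hy : y ∉ tsupport f) :
    diffDensity f θ α y = 0 := by
  have h : f =ᶠ[nhds y] fun _ ↦ 0 := notMem_tsupport_iff_eventuallyEq.1 hy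
  refine diffDensity_eq_zero ?_
  rw [← mvfderiv_const (I := 𝓡 4) (0 : ℝ) (x := y)]
  unfold mvfderiv
  rw [h.mfderiv_eq]
  rfl

omit [IsManifold (𝓡 4) ∞ M] in
theorem diffDensity_add {f₁ f₂ : M → ℝ} {y : M} (hf₁ : MDifferentiableAt (𝓡 4) 𝓘(ℝ, ℝ) f₁ y)
    (hf₂ : MDifferentiableAt (𝓡 4) 𝓘(ℝ, ℝ) f₂ y) :
    diffDensity (fun z ↦ f₁ z + f₂ z) θ α y = diffDensity f₁ θ α y + diffDensity f₂ θ α y := by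
  have h : wedgeOneForms (E := EuclideanSpace ℝ (Fin 4))
      (mvfderiv (𝓡 4) (fun z ↦ f₁ z + f₂ z) y) (θ y) =
      wedgeOneForms (E := EuclideanSpace ℝ (Fin 4)) (mvfderiv (𝓡 4) f₁ y) (θ y) +
      wedgeOneForms (E := EuclideanSpace ℝ (Fin 4)) (mvfderiv (𝓡 4) f₂ y) (θ y) :=
    (congrArg (fun β : EuclideanSpace ℝ (Fin 4) →L[ℝ] ℝ ↦ wedgeOneForms β (θ y))
      (mvfderiv_fun_add hf₁ hf₂)).trans (wedgeOneForms_add _ _ _)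
  refine (congrArg (fun β : EuclideanSpace ℝ (Fin 4) →L[ℝ] EuclideanSpace ℝ (Fin 4) →L[ℝ] ℝ ↦
    wedgeCoeff (fun a b ↦ β (stdFrame a) (stdFrame b))
      (fun a b ↦ α y (stdFrame a) (stdFrame b))) h).trans ?_
  exact wedgeCoeff_add _ _ _

omit [IsManifold (𝓡 4) ∞ M] in
theorem diffDensity_sum {ι : Type*} (s : Finset ι) {f : ι → M → ℝ}
    (hf : ∀ i, ContMDiff (𝓡 4) 𝓘(ℝ, ℝ) ∞ (f i)) (y : M) :
    diffDensity (fun z ↦ ∑ i ∈ s, f i z) θ α y = ∑ i ∈ s, diffDensity (f i) θ α y := by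
  classical
  induction s using Finset.induction_on with
  | empty =>
    simp only [Finset.sum_empty]
    exact diffDensity_eq_zero (mvfderiv_const 0)
  | insert i s hi ih =>
    simp only [Finset.sum_insert hi]
    rw [diffDensity_add ((hf i y).mdifferentiableAt (by simp))
      (((contMDiff_finsetSum fun i _ ↦ hf i) y).mdifferentiableAt (by simp)), ih]

variable [CompactSpace M]

theorem IsExteriorDerivative.chartIntegrable_topDensity (h : IsExteriorDerivative θ α)
    (hf : ContMDiff (𝓡 4) 𝓘(ℝ, ℝ) ∞ f) (hfp : tsupport f ⊆ (extChartAt (𝓡 4) p).source) :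
    ChartIntegrable p (fun y ↦ f y * (J.orientation y * topDensity α y)) := by
  refine integrableOn_chart hfp ?_ ?_
  · refine ((contDiffOn_comp_symm hf p).continuousOn.mul
      (h.continuousOn_topDensity J p)).congr fun x _ ↦ ?_
    simp only [Pi.mul_apply, Function.comp_apply]
    ring
  · intro x _ hx
    simp only [image_eq_zero_of_notMem_tsupport hx, zero_mul, mul_zero]

theorem IsExteriorDerivative.chartIntegrable_diffDensity (h : IsExteriorDerivative θ α)
    (hf : ContMDiff (𝓡 4) 𝓘(ℝ, ℝ) ∞ f) (hfp : tsupport f ⊆ (extChartAt (𝓡 4) p).source) :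
    ChartIntegrable p (fun y ↦ J.orientation y * diffDensity f θ α y) := by
  refine integrableOn_chart hfp (h.continuousOn_diffDensity J p hf) ?_
  intro x _ hx
  simp only [diffDensity_eq_zero_of_notMem_tsupport hx, mul_zero]

theorem IsExteriorDerivative.chartIntegrable_mul_diffDensity (h : IsExteriorDerivative θ α)
    {f₁ f₂ : M → ℝ} (hf₁ : ContMDiff (𝓡 4) 𝓘(ℝ, ℝ) ∞ f₁) (hf₂ : ContMDiff (𝓡 4) 𝓘(ℝ, ℝ) ∞ f₂)
    (hfp : tsupport f₁ ⊆ (extChartAt (𝓡 4) p).source ∨ tsupport f₂ ⊆ (extChartAt (𝓡 4) p).source) :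
    ChartIntegrable p (fun y ↦ f₁ y * (J.orientation y * diffDensity f₂ θ α y)) := by
  have hc : ContinuousOn (fun x ↦ |coordDet (𝓡 4) p ((extChartAt (𝓡 4) p).symm x)| *
      (f₁ ((extChartAt (𝓡 4) p).symm x) * (J.orientation ((extChartAt (𝓡 4) p).symm x) *
        diffDensity f₂ θ α ((extChartAt (𝓡 4) p).symm x)))) (extChartAt (𝓡 4) p).target := by
    refine ((contDiffOn_comp_symm hf₁ p).continuousOn.mul
      (h.continuousOn_diffDensity J p hf₂)).congr fun x _ ↦ ?_
    simp only [Pi.mul_apply, Function.comp_apply]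
    ring
  rcases hfp with hfp | hfp
  · refine integrableOn_chart hfp hc fun x _ hx ↦ ?_
    simp only [image_eq_zero_of_notMem_tsupport hx, zero_mul, mul_zero]
  · refine integrableOn_chart hfp hc fun x _ hx ↦ ?_
    simp only [diffDensity_eq_zero_of_notMem_tsupport hx, mul_zero]

/-- Stokes' theorem for `f • θ ∧ dθ` where `f` is supported in a chart. -/
theorem IsExteriorDerivative.chartIntegral_stokes (h : IsExteriorDerivative θ α)
    (hf : ContMDiff (𝓡 4) 𝓘(ℝ, ℝ) ∞ f) (hfp : tsupport f ⊆ (extChartAt (𝓡 4) p).source) :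
    chartIntegral p (fun y ↦ f y * (J.orientation y * topDensity α y)) +
      chartIntegral p (fun y ↦ J.orientation y * diffDensity f θ α y) = 0 := by
  rw [← chartIntegral_add (h.chartIntegrable_topDensity J hf hfp)
    (h.chartIntegrable_diffDensity J hf hfp)]
  have hsub := tsupport_chartExtension_subset hfp
  rw [← integral_wedge_extDeriv (U := (extChartAt (𝓡 4) p).target)
    (s := fun x ↦ J.chartSign p ((extChartAt (𝓡 4) p).symm x)) (F := chartExtension p f)
    (T := chartComponents θ p) (isOpen_extChartAt_target p)
    (fun x hx ↦ J.eventually_chartSign_symm hx)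
    ((contDiff_chartExtension hf hfp).of_le (by norm_cast))
    (hsub.trans (image_tsupport_subset hfp))
    ((isCompact_image_tsupport hfp).of_isClosed_subset (isClosed_tsupport _) hsub)
    (h.contDiffOn_chartComponents p)]
  refine setIntegral_congr_fun (isOpen_extChartAt_target p).measurableSet fun x hx ↦ ?_
  have hy := (extChartAt (𝓡 4) p).map_target hx
  have hext := chartExtension_eventuallyEq (f := f) hx
  have hdiff : diffWedgeMatrix (chartExtension p f) (chartComponents θ p) x =
      diffWedgeMatrix (f ∘ (extChartAt (𝓡 4) p).symm) (chartComponents θ p) x := by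
    unfold diffWedgeMatrix
    rw [hext.fderiv_eq]
  have h1 := h.topDensity_chart hy
  have h2 := h.diffDensity_chart hy ((hf _).mdifferentiableAt (by simp))
  rw [(extChartAt (𝓡 4) p).right_inv hx] at h1 h2
  simp only
  rw [hdiff, ← h1, ← h2, hext.eq_of_nhds, mul_left_comm (f _), ← mul_add, abs_coordDet_mul]
  simp only [Function.comp_apply]
  ring

end Stokes

end ChartIntegral

/-! ### Globalisation by a partition of unity, and vanishing of the square -/

section Vanishing

open MeasureTheory

theorem orientationSign_ne_zero
    (J : EuclideanSpace ℝ (Fin 4) →L[ℝ] EuclideanSpace ℝ (Fin 4)) : orientationSign J ≠ 0 := by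
  unfold orientationSign
  split_ifs <;> norm_num

variable {M : Type*} [TopologicalSpace M] [T2Space M] [CompactSpace M]
  [ChartedSpace (EuclideanSpace ℝ (Fin 4)) M] [IsManifold (𝓡 4) ∞ M]
  {θ : Π y : M, TangentSpace (𝓡 4) y →L[ℝ] ℝ}
  {α : Π y : M, TangentSpace (𝓡 4) y →L[ℝ] TangentSpace (𝓡 4) y →L[ℝ] ℝ}

/-- On a compact almost-complex four-manifold, an exact two-form whose square is nonnegative has
square zero. -/
theorem IsExteriorDerivative.topDensity_eq_zero (h : IsExteriorDerivative θ α)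
    (J : AlmostComplex (𝓡 4) M) (hnonneg : ∀ y, 0 ≤ J.orientation y * topDensity α y) (y : M) :
    topDensity α y = 0 := by
  obtain ⟨ρ, hρ⟩ := SmoothPartitionOfUnity.exists_isSubordinate_chartAt_source (𝓡 4) M
  have hfin : {i | (Function.support (ρ i)).Nonempty}.Finite :=
    ρ.locallyFinite.finite_nonempty_of_compact
  set s := hfin.toFinset with hs
  have hsum (y : M) : ∑ i ∈ s, ρ i y = 1 := by
    rw [← ρ.sum_eq_one (Set.mem_univ y)]
    refine (finsum_eq_sum_of_support_subset _ fun i hi ↦ ?_).symm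
    rw [hs, Set.Finite.coe_toFinset]
    exact ⟨y, hi⟩
  have hsub (i : M) : tsupport (ρ i) ⊆ (extChartAt (𝓡 4) i).source := by
    rw [extChartAt_source]
    exact hρ i
  have hsm (i : M) : ContMDiff (𝓡 4) 𝓘(ℝ, ℝ) ∞ (ρ i) := (ρ i).contMDiff
  -- The density of ρ_j dρ_i ∧ θ ∧ α. It is supported in both charts, so it may be integrated in
  -- either one.
  let K (i j y : M) : ℝ := ρ j y * (J.orientation y * diffDensity (ρ i) θ α y)
  have hK (i j : M) : chartIntegral i (K i j) = chartIntegral j (K i j) := by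
    refine chartIntegral_eq fun y hy ↦ ⟨hsub i ?_, hsub j ?_⟩
    · by_contra hn
      exact hy (by simp only [K, diffDensity_eq_zero_of_notMem_tsupport hn, mul_zero])
    · by_contra hn
      exact hy (by simp only [K, image_eq_zero_of_notMem_tsupport hn, zero_mul])
  have hsplit (i : M) : chartIntegral i (fun y ↦ J.orientation y * diffDensity (ρ i) θ α y) =
      ∑ j ∈ s, chartIntegral j (K i j) := by
    rw [← Finset.sum_congr rfl fun j _ ↦ hK i j, ← chartIntegral_sum s fun j _ ↦
      h.chartIntegrable_mul_diffDensity J (hsm j) (hsm i) (Or.inr (hsub i))]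
    congr 1
    funext y
    rw [← Finset.sum_mul, hsum, one_mul]
  -- In the fixed chart j, summing over i gives dρ_i summed to d1 = 0.
  have hzero (j : M) : ∑ i ∈ s, chartIntegral j (K i j) = 0 := by
    rw [← chartIntegral_sum s fun i _ ↦
      h.chartIntegrable_mul_diffDensity J (hsm j) (hsm i) (Or.inl (hsub j))]
    have h0 (y : M) : ∑ i ∈ s, K i j y = 0 := by
      simp only [K]
      rw [← Finset.mul_sum, ← Finset.mul_sum, ← diffDensity_sum s hsm]
      simp only [hsum]
      rw [diffDensity_eq_zero (mvfderiv_const 1)]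
      simp
    refine (congrArg (chartIntegral j) (funext h0)).trans ?_
    simp [chartIntegral]
  -- Stokes in chart i makes each summand minus the integral of dρ_i ∧ θ ∧ α; inserting ∑ ρ_j = 1,
  -- moving to chart j and exchanging the sums makes everything cancel.
  have htotal : ∑ i ∈ s, chartIntegral i (fun y ↦ ρ i y * (J.orientation y * topDensity α y)) =
      0 := by
    have hst (i : M) : chartIntegral i (fun y ↦ ρ i y * (J.orientation y * topDensity α y)) =
        -∑ j ∈ s, chartIntegral j (K i j) := by
      rw [← hsplit]
      exact eq_neg_of_add_eq_zero_left (h.chartIntegral_stokes J (hsm i) (hsub i))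
    simp only [hst, Finset.sum_neg_distrib]
    rw [Finset.sum_comm]
    simp only [hzero, Finset.sum_const_zero, neg_zero]
  have hpos (i y : M) : 0 ≤ ρ i y * (J.orientation y * topDensity α y) :=
    mul_nonneg (ρ.nonneg i y) (hnonneg y)
  have hint (i : M) :
      0 ≤ chartIntegral i (fun y ↦ ρ i y * (J.orientation y * topDensity α y)) :=
    integral_nonneg fun x ↦ mul_nonneg (abs_nonneg _) (hpos i _)
  have heach := (Finset.sum_eq_zero_iff_of_nonneg fun i _ ↦ hint i).1 htotal
  obtain ⟨i, hi⟩ := ρ.exists_pos_of_mem (Set.mem_univ y)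
  have his : i ∈ s := hfin.mem_toFinset.2 ⟨y, hi.ne'⟩
  have hy : y ∈ (extChartAt (𝓡 4) i).source := hsub i (subset_tsupport _ hi.ne')
  -- A nonnegative density with zero integral vanishes almost everywhere in the chart; continuity
  -- then gives vanishing at every point, in particular at y, where ρ_i is positive.
  have hae := (setIntegral_eq_zero_iff_of_nonneg_ae
    (Filter.Eventually.of_forall fun x ↦ mul_nonneg (abs_nonneg _) (hpos i _))
    (h.chartIntegrable_topDensity J (hsm i) (hsub i))).1 (heach i his)
  have hcont : ContinuousOn (fun x ↦ |coordDet (𝓡 4) i ((extChartAt (𝓡 4) i).symm x)| *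
      (ρ i ((extChartAt (𝓡 4) i).symm x) * (J.orientation ((extChartAt (𝓡 4) i).symm x) *
        topDensity α ((extChartAt (𝓡 4) i).symm x)))) (extChartAt (𝓡 4) i).target := by
    refine ((contDiffOn_comp_symm (hsm i) i).continuousOn.mul
      (h.continuousOn_topDensity J i)).congr fun x _ ↦ ?_
    simp only [Pi.mul_apply, Function.comp_apply]
    ring
  have heq := Measure.eqOn_open_of_ae_eq hae (isOpen_extChartAt_target i) hcont continuousOn_const
    ((extChartAt (𝓡 4) i).map_source hy)
  simp only [(extChartAt (𝓡 4) i).left_inv hy] at heq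
  have hdet := coordDet_ne_zero (I := 𝓡 4) hy
  have hor : J.orientation y ≠ 0 := orientationSign_ne_zero _
  simpa [hdet, hi.ne', hor] using heq

omit [T2Space M] [CompactSpace M] in
theorem isExteriorDerivative_commutatorForm {g : Metric (𝓡 4) M} {J : AlmostComplex (𝓡 4) M}
    {D : CovariantDerivative (𝓡 4) (EuclideanSpace ℝ (Fin 4)) (TangentSpace (𝓡 4) : M → Type _)}
    (hgJ : ∀ (x : M) (u w : TangentSpace (𝓡 4) x),
      g.val x (J.val x u) (J.val x w) = g.val x u w)
    (hD : IsLeviCivita g D) (hJ : IsParallel D J) {v : Π x : M, TangentSpace (𝓡 4) x}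
    (hv : IsKilling g v) :
    IsExteriorDerivative (kahlerOneForm g J v) (commutatorForm g J D v) where
  contMDiffAt p c y hy :=
    g.contMDiffAt_apply (J.contMDiffAt_apply (hv.contMDiff y)) (contMDiffAt_coordField hy c)
  skew y u w := commutatorForm_skew hgJ hv hD y u w
  eq_extDeriv p c d y hy :=
    extDeriv_kahlerOneForm hgJ hv hD hJ ((contMDiffAt_coordField hy c).mdifferentiableAt (by simp))
      ((contMDiffAt_coordField hy d).mdifferentiableAt (by simp)) (mlieBracket_coordField hy c d)

end Vanishing

end PseudoKahler

end

theorem theoremB {M : Type*} [TopologicalSpace M] [T2Space M] [CompactSpace M]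
    [ChartedSpace (EuclideanSpace ℝ (Fin 4)) M] [IsManifold (𝓡 4) ∞ M]
    (g : PseudoKahler.Metric (𝓡 4) M) (J : PseudoKahler.AlmostComplex (𝓡 4) M)
    (hgJ : PseudoKahler.IsPseudoKahler g J)
    (v : Π x : M, TangentSpace (𝓡 4) x) (hv : PseudoKahler.IsKilling g v) :
    PseudoKahler.IsRealHolomorphic J v := by
  obtain ⟨D, hD, hJ⟩ := hgJ.parallel
  have h := PseudoKahler.isExteriorDerivative_commutatorForm hgJ.isometry hD hJ hv
  refine PseudoKahler.isRealHolomorphic_of_commutatorForm_eq_zero hv hD hJ fun x ↦ ?_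
  refine PseudoKahler.eq_zero_of_wedgeCoeff_eq_zero (J.sq x) (h.skew x)
    (PseudoKahler.commutatorForm_complex hgJ.isometry x) (h.topDensity_eq_zero J (fun y ↦ ?_) x)
  exact PseudoKahler.orientationSign_mul_wedgeCoeff_nonneg (J.sq y) (h.skew y)
    (PseudoKahler.commutatorForm_complex hgJ.isometry y)
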